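/- Let $\mathbb K$ be a field, let $f_1,\dots,f_t\in\mathbb K[x,y]$ and $J=\langle f_1,\dots,f_t\rangle$. Let $I\subset\mathbb K[x,y]$ be an $\langle x,y\rangle$-primary ideal for which there is an ideal $I'$ with $I+I'=\langle 1\rangle$ and $II'=J$ (that is, $I$ is the $\langle x,y\rangle$-primary component of $J$, with the origin isolated in $V(J)$). Use the lexicographic order with $y\succ x$, and let $\boldsymbol E=(y^{n_0},x^{m_1}y^{n_1},\dots,x^{m_{s-1}}y^{n_{s-1}},x^{m_s})$, with $0=m_0<m_1<\dots<m_s$ and $n_0>\dots>n_s=0$, be the minimal monomial generators of the initial ideal of $I$. Put $d_i=m_i-m_{i-1}$ and $e_i=n_{i-1}-n_i$ for $1\le i\le s$, and let $\mu_1,\dots,\mu_\delta$ be the monomials not in $\langle\boldsymbol E\rangle$. *Gröbner parameters.* For $0\le i\le s-1$ and $i\le j\le s$ let $\sigma_{j,i}$ be a polynomial in $x,y$ with $\deg_x\sigma_{j,i}<d_{i+1}$, with $\deg_y\sigma_{j,i}<e_j$ if $j>i$, and with $\sigma_{i,i}$ depending on $x$ only. Denote the vector of all the coefficients of these polynomials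 by $\lambda=(\lambda_1,\dots,\lambda_N)$. Let $h_0,\dots,h_s$ be the polynomials determined by $h_s=\prod_{i=1}^s(x^{d_i}-\sigma_{i-1,i-1})$ and $$x^{d_{i+1}}h_i-y^{e_{i+1}}h_{i+1}=\sigma_{i,i}h_i+\sigma_{i+1,i}h_{i+1}+\dots+\sigma_{s,i}h_s\qquad(0\le i<s);$$ $h_i$ has initial term $x^{m_i}y^{n_i}$. The Gröbner parameters of $I$ are the $\lambda$ with $\langle h_0,\dots,h_s\rangle=I$. Call a parameter *punctual* if it is not a coefficient of some $\sigma_{i,i}$ and not the coefficient of a monomial $y^b$ in some $\sigma_{i+1,i}$; let $\sigma_1,\dots,\sigma_{N'}$ be the indices of the punctual parameters. *Equations.* Let $\Lambda_1,\dots,\Lambda_N$ be indeterminates. For $1\le i\le t$ and $1\le j\le\delta$ let $\mathscr E_{i,j}\in\mathbb K[\Lambda_1,\dots,\Lambda_N]$ be the coefficient of $\mu_j$ in the remainder of $f_i$ modulo the lexicographic Gröbner basis with parameters $(\Lambda_1,\dots,\Lambda_N)$, that is, in the unique linear combination $r$ of $\mu_1,\dots,\mu_\delta$ such that $f_i-r$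 lies in the ideal generated by the polynomials $h_0,\dots,h_s$ with parameters $(\Lambda_1,\dots,\Lambda_N)$. Let $\mathscr F_{i,j}\in\mathbb K[\Lambda_{\sigma_1},\dots,\Lambda_{\sigma_{N'}}]$ be obtained from $\mathscr E_{i,j}$ by setting all non-punctual indeterminates to zero. Then $I$ has exactly one vector of Gröbner parameters $(\lambda_1,\dots,\lambda_N)\in\mathbb K^N$, its non-punctual entries are zero, and $$\langle\mathscr F_{1,1},\dots,\mathscr F_{t,\delta}\rangle=\langle\Lambda_{\sigma_1}-\lambda_{\sigma_1},\dots,\Lambda_{\sigma_{N'}}-\lambda_{\sigma_{N'}}\rangle\quad\text{in }\mathbb K[\Lambda_{\sigma_1},\dots,\Lambda_{\sigma_{N'}}],$$ which is a maximal ideal. In particular, $(\lambda_{\sigma_1},\dots,\lambda_{\sigma_{N'}})$ is the unique common zero of the $\mathscr F_{i,j}$ over an algebraic closure $\overline{\mathbb K}$, and it is simple: the local ring of $\mathbb K[\Lambda_{\sigma_1},\dots,\Lambda_{\sigma_{N'}}]/\langle\mathscr F_{1,1},\dots,\mathscr F_{t,\delta}\rangle$ at this point has dimension $1$ over $\mathbb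 K$, and the Jacobian matrix of the $\mathscr F_{i,j}$ at this point has trivial kernel. -/

import Mathlib

open MvPolynomial

/-- The lexicographic order on the monomials of `R[x, y]` induced by `y ≻ x`.  Mathlib's
`MonomialOrder.lex` makes `X 0` larger than `X 1`, so the variable `y` is `X 0` and `x` is `X 1`. -/
noncomputable abbrev lexYX : MonomialOrder (Fin 2) := MonomialOrder.lex

/-- The variable `x` of `R[x, y]` (the smaller one). -/
noncomputable abbrev varX (R : Type*) [CommRing R] : MvPolynomial (Fin 2) R := X 1

/-- The variable `y` of `R[x, y]` (the larger one). -/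
noncomputable abbrev varY (R : Type*) [CommRing R] : MvPolynomial (Fin 2) R := X 0

/-- The initial ideal of an ideal of `K[x, y]`: the ideal generated by the leading terms of all its
elements. -/
noncomputable def initialIdeal {K : Type*} [Field K] (I : Ideal (MvPolynomial (Fin 2) K)) :
    Ideal (MvPolynomial (Fin 2) K) :=
  Ideal.span (lexYX.leadingTerm '' (I : Set (MvPolynomial (Fin 2) K)))

/-- The exponents of a tuple of monomials
`E = (y ^ n 0, x ^ m 1 * y ^ n 1, …, x ^ m (s - 1) * y ^ n (s - 1), x ^ m s)`,
with `0 = m 0 < m 1 < ⋯ < m s` and `n 0 > ⋯ > n (s - 1) > n s = 0`, that is, of the minimal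
generators of a zero-dimensional monomial ideal.  Only the values at `i ≤ s` are used. -/
structure Staircase where
  s : ℕ
  m : ℕ → ℕ
  n : ℕ → ℕ
  m_zero : m 0 = 0
  n_last : n s = 0
  m_lt : ∀ i < s, m i < m (i + 1)
  n_lt : ∀ i < s, n (i + 1) < n i

namespace Staircase

variable (E : Staircase)

/-- `d i = m i - m (i - 1)`, for `i = 1, …, s`. -/
def d (i : ℕ) : ℕ := E.m i - E.m (i - 1)

/-- `e i = n (i - 1) - n i`, for `i = 1, …, s`. -/
def e (i : ℕ) : ℕ := E.n (i - 1) - E.n i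

/-- The exponent vector of `x ^ m i * y ^ n i`. -/
noncomputable def expo (i : ℕ) : Fin 2 →₀ ℕ := Finsupp.single 0 (E.n i) + Finsupp.single 1 (E.m i)

/-- The monomial ideal `⟨E⟩`. -/
noncomputable def monomialIdeal (K : Type*) [Field K] : Ideal (MvPolynomial (Fin 2) K) :=
  Ideal.span {p | ∃ i ≤ E.s, p = monomial (E.expo i) 1}

/-- The initial segment determined by `E`: the exponents of the monomials `μ 1, …, μ δ` that are not
in `⟨E⟩`. -/
def seg : Set (Fin 2 →₀ ℕ) := {u | ∀ i ≤ E.s, ¬ E.expo i ≤ u}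

/-- The index set of the Gröbner parameters: `⟨i, j, a, b, …⟩` is the index of the coefficient of
`x ^ a * y ^ b` in `σ_{j, i}`, where `0 ≤ i < s`, `i ≤ j ≤ s`, `a < d (i + 1)`, and `b = 0` if
`j = i`, `b < e j` if `j > i`. -/
structure Param where
  i : ℕ
  j : ℕ
  a : ℕ
  b : ℕ
  hi : i < E.s
  hij : i ≤ j
  hj : j ≤ E.s
  ha : a < E.d (i + 1)
  hb : if j = i then b = 0 else b < E.e j

instance : Finite E.Param := by
  refine Finite.of_injective
    (β := Σ i : Fin E.s, Σ j : Fin (E.s + 1), Fin (E.d (i + 1)) × Fin (E.e j + 1))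
    (fun p => ⟨⟨p.i, p.hi⟩, ⟨p.j, Nat.lt_succ_of_le p.hj⟩, ⟨p.a, p.ha⟩, ⟨p.b, ?_⟩⟩) ?_
  · have := p.hb
    split_ifs at this <;> simp only <;> omega
  · rintro ⟨i, j, a, b, _, _, _, _, _⟩ ⟨i', j', a', b', _, _, _, _, _⟩ h
    simp only [Sigma.mk.injEq, Fin.mk.injEq] at h
    obtain ⟨rfl, h⟩ := h
    simp only [heq_eq_eq, Sigma.mk.injEq, Fin.mk.injEq] at h
    obtain ⟨rfl, h⟩ := h
    simp only [heq_eq_eq, Prod.mk.injEq, Fin.mk.injEq] at h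
    obtain ⟨rfl, rfl⟩ := h
    rfl

noncomputable instance : Fintype E.Param := Fintype.ofFinite _

/-- The parameters that are kept on the punctual Gröbner cell: the `σ_{i, i}` are set to zero, and
so are the coefficients of `σ_{i + 1, i}` that are not divisible by `x`. -/
def IsPunctual (p : E.Param) : Prop := p.j ≠ p.i ∧ (p.j = p.i + 1 → p.a ≠ 0)

/-- The index set of the punctual Gröbner parameters. -/
abbrev PunctualParam : Type := {p : E.Param // E.IsPunctual p}

noncomputable instance : Fintype E.PunctualParam := Fintype.ofFinite _

variable {R : Type*} [CommRing R]

open Classical in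
/-- The polynomial `σ_{j, i}` with coefficients given by the parameters `c`. -/
noncomputable def sigma (c : E.Param → R) (j i : ℕ) : MvPolynomial (Fin 2) R :=
  ∑ p : E.Param, if p.i = i ∧ p.j = j then C (c p) * varX R ^ p.a * varY R ^ p.b else 0

/-- `D i = x ^ d i - σ_{i - 1, i - 1}`, for `i = 1, …, s`. -/
noncomputable def D (c : E.Param → R) (i : ℕ) : MvPolynomial (Fin 2) R :=
  varX R ^ E.d i - E.sigma c (i - 1) (i - 1)

/-- The polynomials `H s = 1` and
`H i = y ^ e (i + 1) * H (i + 1) + ∑_{j = i + 1}^s σ_{j, i} * D (i + 2) ⋯ D j * H j`. -/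
noncomputable def cofactor (c : E.Param → R) (i : ℕ) : MvPolynomial (Fin 2) R :=
  if _hi : i < E.s then
    varY R ^ E.e (i + 1) * cofactor c (i + 1) +
      ∑ j ∈ (Finset.Ioc i E.s).attach,
        E.sigma c j.1 i * (∏ k ∈ Finset.Icc (i + 2) j.1, E.D c k) * cofactor c j.1
  else 1
termination_by E.s - i
decreasing_by
  · omega
  · have := Finset.mem_Ioc.1 j.2
    omega

/-- The Gröbner basis elements `h i` with parameters `c`: `h i = D 1 ⋯ D i * H i`.  By
`h_last`, `h_syzygy` and `eq_h_of_syzygy` below these are the unique polynomials such that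
`h s = (x ^ d 1 - σ_{0, 0}) ⋯ (x ^ d s - σ_{s - 1, s - 1})` and
`x ^ d (i + 1) * h i - y ^ e (i + 1) * h (i + 1) = σ_{i, i} * h i + ⋯ + σ_{s, i} * h s` for
`i < s`. -/
noncomputable def h (c : E.Param → R) (i : ℕ) : MvPolynomial (Fin 2) R :=
  (∏ k ∈ Finset.Icc 1 i, E.D c k) * E.cofactor c i

/-- The ideal generated by `h 0, …, h s`. -/
noncomputable def idealOf (c : E.Param → R) : Ideal (MvPolynomial (Fin 2) R) :=
  Ideal.span {p | ∃ i ≤ E.s, p = E.h c i}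

/-- `r` is the remainder of `f` modulo the Gröbner basis with parameters `c`: `f - r` lies in the
ideal `⟨h 0, …, h s⟩` and no monomial of `r` lies in its initial ideal `⟨E⟩`.  It depends on the
ideal only, so it is also the remainder modulo the reduced Gröbner basis `g 0, …, g s` of that
ideal. -/
def IsRemainder (c : E.Param → R) (f r : MvPolynomial (Fin 2) R) : Prop :=
  f - r ∈ E.idealOf c ∧ (r.support : Set (Fin 2 →₀ ℕ)) ⊆ E.seg

/-! ### Basic facts: the syzygies, the initial terms, existence and uniqueness of remainders -/

section facts

variable {E}

theorem d_pos {i : ℕ} (hi : i < E.s) : 0 < E.d (i + 1) := by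
  have := E.m_lt i hi
  simp only [d, Nat.add_sub_cancel]
  omega

theorem m_add_d {i : ℕ} (hi : i < E.s) : E.m i + E.d (i + 1) = E.m (i + 1) := by
  have := E.m_lt i hi
  simp only [d, Nat.add_sub_cancel]
  omega

theorem e_pos {i : ℕ} (hi : i < E.s) : 0 < E.e (i + 1) := by
  have := E.n_lt i hi
  simp only [e, Nat.add_sub_cancel]
  omega

theorem n_add_e {i : ℕ} (hi : i < E.s) : E.n (i + 1) + E.e (i + 1) = E.n i := by
  have := E.n_lt i hi
  simp only [e, Nat.add_sub_cancel]
  omega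

theorem m_mono {i j : ℕ} (hij : i ≤ j) (hj : j ≤ E.s) : E.m i ≤ E.m j := by
  induction j, hij using Nat.le_induction with
  | base => exact le_rfl
  | succ k _ ih => exact (ih (by omega)).trans (E.m_lt k (by omega)).le

theorem n_anti {i j : ℕ} (hij : i ≤ j) (hj : j ≤ E.s) : E.n j ≤ E.n i := by
  induction j, hij using Nat.le_induction with
  | base => exact le_rfl
  | succ k _ ih => exact (E.n_lt k (by omega)).le.trans (ih (by omega))

theorem cofactor_last (c : E.Param → R) : E.cofactor c E.s = 1 := by
  rw [cofactor]; simp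

theorem cofactor_step (c : E.Param → R) {i : ℕ} (hi : i < E.s) :
    E.cofactor c i = varY R ^ E.e (i + 1) * E.cofactor c (i + 1) +
      ∑ j ∈ Finset.Ioc i E.s,
        E.sigma c j i * (∏ k ∈ Finset.Icc (i + 2) j, E.D c k) * E.cofactor c j := by
  conv_lhs => rw [cofactor]
  rw [dif_pos hi]
  congr 1
  exact Finset.sum_attach (Finset.Ioc i E.s) (fun j =>
    E.sigma c j i * (∏ k ∈ Finset.Icc (i + 2) j, E.D c k) * E.cofactor c j)

theorem h_last (c : E.Param → R) : E.h c E.s = ∏ k ∈ Finset.Icc 1 E.s, E.D c k := by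
  rw [h, cofactor_last, mul_one]

theorem D_mul_h (c : E.Param → R) {i : ℕ} (hi : i < E.s) :
    E.D c (i + 1) * E.h c i = varY R ^ E.e (i + 1) * E.h c (i + 1) +
      ∑ j ∈ Finset.Ioc i E.s, E.sigma c j i * E.h c j := by
  have key : ∀ l, (∏ k ∈ Finset.Icc 1 i, E.D c k) * E.D c (i + 1) *
      (∏ k ∈ Finset.Icc (i + 2) (i + 1 + l), E.D c k) =
        ∏ k ∈ Finset.Icc 1 (i + 1 + l), E.D c k := by
    intro l
    induction l with
    | zero => rw [add_zero, Finset.Icc_eq_empty (a := i + 2) (by omega), Finset.prod_empty,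
        mul_one, Finset.prod_Icc_succ_top (by omega)]
    | succ l ih =>
      rw [← add_assoc, Finset.prod_Icc_succ_top (by omega),
        Finset.prod_Icc_succ_top (a := 1) (b := i + 1 + l) (by omega), ← ih, ← mul_assoc]
  rw [h, cofactor_step c hi, mul_left_comm, mul_add, mul_add, Finset.mul_sum, Finset.mul_sum]
  congr 1
  · rw [h, Finset.prod_Icc_succ_top (by omega)]
    ring
  · refine Finset.sum_congr rfl fun j hj => ?_
    obtain ⟨l, rfl⟩ : ∃ l, j = i + 1 + l := ⟨j - (i + 1), by have := Finset.mem_Ioc.1 hj; omega⟩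
    rw [h, ← key l]
    ring

theorem h_syzygy (c : E.Param → R) {i : ℕ} (hi : i < E.s) :
    varX R ^ E.d (i + 1) * E.h c i - varY R ^ E.e (i + 1) * E.h c (i + 1) =
      ∑ j ∈ Finset.Icc i E.s, E.sigma c j i * E.h c j := by
  have := D_mul_h c hi
  rw [D, Nat.add_sub_cancel] at this
  rw [← Finset.Ioc_insert_left hi.le, Finset.sum_insert (by simp)]
  linear_combination this

theorem support_sigma (c : E.Param → R) {i j : ℕ} {u : Fin 2 →₀ ℕ}
    (hu : u ∈ (E.sigma c j i).support) :
    u 1 < E.d (i + 1) ∧ (if j = i then u 0 = 0 else u 0 < E.e j) := by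
  classical
  obtain ⟨p, -, hp⟩ := Finset.mem_biUnion.1 (MvPolynomial.support_sum hu)
  split_ifs at hp with hpi
  · obtain ⟨rfl, rfl⟩ := hpi
    have h1 : C (c p) * varX R ^ p.a * varY R ^ p.b =
        monomial (Finsupp.single 0 p.b + Finsupp.single 1 p.a) (c p) := by
      rw [X_pow_eq_monomial, X_pow_eq_monomial, C_mul_monomial, monomial_mul, mul_one, mul_one,
        add_comm]
    rw [h1] at hp
    obtain rfl := Finset.mem_singleton.1 (support_monomial_subset hp)
    have := p.hb
    have := p.ha
    simpa using ⟨p.ha, p.hb⟩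
  · simp at hp

theorem lex_lt_of_zero {u v : Fin 2 →₀ ℕ} (huv : u 0 < v 0) :
    lexYX.toSyn u < lexYX.toSyn v := by
  rw [MonomialOrder.lex_lt_iff]
  exact ⟨0, fun j hj => absurd hj (by simp), huv⟩

theorem lex_lt_of_one {u v : Fin 2 →₀ ℕ} (h0 : u 0 = v 0) (h1 : u 1 < v 1) :
    lexYX.toSyn u < lexYX.toSyn v := by
  rw [MonomialOrder.lex_lt_iff]
  refine ⟨1, fun j hj => ?_, h1⟩
  obtain rfl : j = 0 := by omega
  exact h0

theorem zero_le_of_lex_le {u v : Fin 2 →₀ ℕ} (huv : lexYX.toSyn u ≤ lexYX.toSyn v) :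
    u 0 ≤ v 0 := by
  by_contra! hlt
  exact absurd (lex_lt_of_zero hlt) (not_lt.2 huv)

theorem monic_add_of_support [Nontrivial R] {f g : MvPolynomial (Fin 2) R} (hf : lexYX.Monic f)
    (hg : ∀ u ∈ g.support, lexYX.toSyn u < lexYX.toSyn (lexYX.degree f)) :
    lexYX.Monic (f + g) ∧ lexYX.degree (f + g) = lexYX.degree f := by
  by_cases hg0 : g = 0
  · subst hg0; simpa using hf
  · have hlt := hg _ (lexYX.degree_mem_support hg0)
    exact ⟨hf.add_of_lt hlt, lexYX.degree_add_of_lt hlt⟩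

theorem monic_D [Nontrivial R] (c : E.Param → R) (i : ℕ) :
    lexYX.Monic (E.D c (i + 1)) ∧
      lexYX.degree (E.D c (i + 1)) = Finsupp.single 1 (E.d (i + 1)) := by
  have hm : lexYX.Monic (varX R ^ E.d (i + 1)) := MonomialOrder.monic_X.pow
  have hd : lexYX.degree (varX R ^ E.d (i + 1)) = Finsupp.single 1 (E.d (i + 1)) := by
    classical
    rw [X_pow_eq_monomial, lexYX.degree_monomial, if_neg one_ne_zero]
  rw [D, sub_eq_add_neg, ← hd]
  refine monic_add_of_support hm fun u hu => ?_
  rw [support_neg, Nat.add_sub_cancel] at hu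
  have := support_sigma c hu
  rw [if_pos rfl] at this
  rw [hd]
  exact lex_lt_of_one (by simp [this.2]) (by simpa using this.1)

theorem monic_mul_degree [Nontrivial R] {f g : MvPolynomial (Fin 2) R} (hf : lexYX.Monic f)
    (hg : lexYX.Monic g) :
    lexYX.Monic (f * g) ∧ lexYX.degree (f * g) = lexYX.degree f + lexYX.degree g :=
  ⟨hf.mul hg, lexYX.degree_mul_of_left_mem_nonZeroDivisors
    (by rw [hf.leadingCoeff_eq_one]; exact one_mem _) hg.ne_zero⟩

theorem degreeOf_zero_prod_D (c : E.Param → R) (i j : ℕ) :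
    degreeOf 0 (∏ k ∈ Finset.Icc (i + 2) j, E.D c k) = 0 := by
  refine Nat.le_zero.1 ((degreeOf_prod_le _ _ _).trans (Finset.sum_nonpos fun k hk => ?_))
  obtain ⟨l, rfl⟩ : ∃ l, k = l + 1 := ⟨k - 1, by have := (Finset.mem_Icc.1 hk).1; omega⟩
  refine (degreeOf_sub_le _ _ _).trans (max_le ?_ ?_)
  · refine (degreeOf_pow_le _ _ _).trans ?_
    rw [degreeOf_X_of_ne (by decide), mul_zero]
  · rw [degreeOf_le_iff]
    intro u hu
    have := (support_sigma c hu).2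
    rw [if_pos rfl] at this
    exact this.le

theorem monic_cofactor [Nontrivial R] (c : E.Param → R) {i : ℕ} (hi : i ≤ E.s) :
    lexYX.Monic (E.cofactor c i) ∧
      lexYX.degree (E.cofactor c i) = Finsupp.single 0 (E.n i) := by
  classical
  induction hk : E.s - i using Nat.strong_induction_on generalizing i with
  | _ k ih =>
  rcases hi.eq_or_lt with rfl | hi
  · rw [cofactor_last]
    exact ⟨MonomialOrder.monic_one, by rw [E.n_last]; simp⟩
  · have h1 := ih (E.s - (i + 1)) (by omega) (i := i + 1) (by omega) rfl
    have hy : lexYX.Monic (varY R ^ E.e (i + 1)) := MonomialOrder.monic_X.pow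
    have hyd : lexYX.degree (varY R ^ E.e (i + 1)) = Finsupp.single 0 (E.e (i + 1)) := by
      rw [X_pow_eq_monomial, lexYX.degree_monomial, if_neg one_ne_zero]
    have h2 := monic_mul_degree hy h1.1
    have h3 : lexYX.degree (varY R ^ E.e (i + 1) * E.cofactor c (i + 1)) =
        Finsupp.single 0 (E.n i) := by
      rw [h2.2, hyd, h1.2, ← Finsupp.single_add, ← n_add_e hi, add_comm]
    rw [cofactor_step c hi, ← h3]
    refine monic_add_of_support h2.1 fun u hu => ?_
    rw [h3]
    refine lex_lt_of_zero ?_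
    rw [Finsupp.single_eq_same]
    obtain ⟨j, hj, hu⟩ := Finset.mem_biUnion.1 (MvPolynomial.support_sum hu)
    obtain ⟨hij, hjs⟩ := Finset.mem_Ioc.1 hj
    obtain ⟨l, rfl⟩ : ∃ l, j = l + 1 := ⟨j - 1, by omega⟩
    have hd1 := degreeOf_zero_prod_D c i (l + 1)
    have hc := ih (E.s - (l + 1)) (by omega) (i := l + 1) (by omega) rfl
    have hd2 : degreeOf 0 (E.cofactor c (l + 1)) ≤ E.n (l + 1) := by
      rw [degreeOf_le_iff]
      intro v hv
      have := zero_le_of_lex_le (lexYX.le_degree hv)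
      rwa [hc.2, Finsupp.single_eq_same] at this
    have hd3 : degreeOf 0 (E.sigma c (l + 1) i) < E.e (l + 1) := by
      rw [degreeOf_lt_iff (e_pos (by omega))]
      intro v hv
      have := (support_sigma c hv).2
      rwa [if_neg (by omega)] at this
    have hd4 := (degreeOf_mul_le 0 (E.sigma c (l + 1) i * ∏ k ∈ Finset.Icc (i + 2) (l + 1), E.D c k)
      (E.cofactor c (l + 1))).trans (add_le_add_left (degreeOf_mul_le _ _ _) _)
    have hd5 := (degreeOf_le_iff.1 hd4) u hu
    have := n_add_e (E := E) (i := l) (by omega)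
    have := n_anti (E := E) (i := i) (j := l) (by omega) (by omega)
    omega

/-- The leading term of `h i` is `x ^ m i * y ^ n i`. -/
theorem monic_h [Nontrivial R] (c : E.Param → R) {i : ℕ} (hi : i ≤ E.s) :
    lexYX.Monic (E.h c i) ∧ lexYX.degree (E.h c i) = E.expo i := by
  have key : lexYX.Monic (∏ k ∈ Finset.Icc 1 i, E.D c k) ∧
      lexYX.degree (∏ k ∈ Finset.Icc 1 i, E.D c k) = Finsupp.single 1 (E.m i) := by
    induction i with
    | zero => simp [E.m_zero, MonomialOrder.monic_one]
    | succ i ih =>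
      have h1 := ih (by omega)
      have h2 := monic_D (E := E) c i
      have h3 := monic_mul_degree h1.1 h2.1
      rw [Finset.prod_Icc_succ_top (by omega)]
      refine ⟨h3.1, ?_⟩
      rw [h3.2, h1.2, h2.2, ← Finsupp.single_add, m_add_d (by omega)]
  have h2 := monic_cofactor c hi
  have h3 := monic_mul_degree key.1 h2.1
  exact ⟨h3.1, by rw [h, h3.2, key.2, h2.2, expo, add_comm]⟩

/-- The syzygies determine `h 0, …, h s`. -/
theorem eq_h_of_syzygy [Nontrivial R] (c : E.Param → R) (g : ℕ → MvPolynomial (Fin 2) R)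
    (hlast : g E.s = ∏ k ∈ Finset.Icc 1 E.s, E.D c k)
    (hsyz : ∀ i < E.s, varX R ^ E.d (i + 1) * g i - varY R ^ E.e (i + 1) * g (i + 1) =
      ∑ j ∈ Finset.Icc i E.s, E.sigma c j i * g j) {i : ℕ} (hi : i ≤ E.s) :
    g i = E.h c i := by
  induction hk : E.s - i using Nat.strong_induction_on generalizing i with
  | _ k ih =>
  rcases hi.eq_or_lt with rfl | hi
  · rw [hlast, h_last]
  · have h1 := hsyz i hi
    have h2 := h_syzygy c hi
    rw [← Finset.Ioc_insert_left hi.le, Finset.sum_insert (by simp)] at h1 h2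
    have h3 : ∑ j ∈ Finset.Ioc i E.s, E.sigma c j i * g j =
        ∑ j ∈ Finset.Ioc i E.s, E.sigma c j i * E.h c j := by
      refine Finset.sum_congr rfl fun j hj => ?_
      have := Finset.mem_Ioc.1 hj
      rw [ih (E.s - j) (by omega) (i := j) (by omega) rfl]
    rw [h3, ih (E.s - (i + 1)) (by omega) (i := i + 1) (by omega) rfl] at h1
    have h4 : E.D c (i + 1) * (g i - E.h c i) = 0 := by
      rw [D, Nat.add_sub_cancel]
      linear_combination h1 - h2
    have h5 : E.D c (i + 1) ∈ nonZeroDivisors (MvPolynomial (Fin 2) R) :=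
      lexYX.mem_nonZeroDivisors_of_leadingCoeff_mem_nonZeroDivisors
        (by rw [(monic_D c i).1.leadingCoeff_eq_one]; exact one_mem _)
    exact sub_eq_zero.1 ((mul_left_mem_nonZeroDivisors_eq_zero_iff h5).1 h4)

theorem h_mem (c : E.Param → R) {i : ℕ} (hi : i ≤ E.s) : E.h c i ∈ E.idealOf c :=
  Ideal.subset_span ⟨i, hi, rfl⟩

theorem exists_isRemainder (c : E.Param → R) (f : MvPolynomial (Fin 2) R) :
    ∃ r, E.IsRemainder c f r := by
  cases subsingleton_or_nontrivial R
  · exact ⟨0, by rw [Subsingleton.elim (f - 0) 0]; exact zero_mem _, by simp⟩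
  obtain ⟨g, r, hf, -, hr⟩ := lexYX.div (b := fun i : Fin (E.s + 1) => E.h c i)
    (fun i => by
      rw [(monic_h c (Nat.lt_succ_iff.1 i.2)).1.leadingCoeff_eq_one]; exact isUnit_one) f
  refine ⟨r, ?_, fun u hu i hi => ?_⟩
  · rw [hf, add_sub_cancel_right, Finsupp.linearCombination_apply]
    exact sum_mem fun i _ => Ideal.mul_mem_left _ _ (h_mem c (Nat.lt_succ_iff.1 i.2))
  · have := hr u hu ⟨i, Nat.lt_succ_iff.2 hi⟩
    rwa [(monic_h c hi).2] at this

/-- Every element of `⟨h 0, …, h s⟩` is a combination of the `h i` with coefficients of `x`-degree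
less than `d (i + 1)`, for `i < s`. -/
theorem exists_normal_combination [Nontrivial R] (c : E.Param → R) {p : MvPolynomial (Fin 2) R}
    (hp : p ∈ E.idealOf c) :
    ∃ a : ℕ → MvPolynomial (Fin 2) R, (∀ i < E.s, ∀ u ∈ (a i).support, u 1 < E.d (i + 1)) ∧
      p = ∑ i ∈ Finset.range (E.s + 1), a i * E.h c i := by
  classical
  let S : AddSubmonoid (MvPolynomial (Fin 2) R) :=
    { carrier := {p | ∃ a : ℕ → MvPolynomial (Fin 2) R,
        (∀ i < E.s, ∀ u ∈ (a i).support, u 1 < E.d (i + 1)) ∧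
        p = ∑ i ∈ Finset.range (E.s + 1), a i * E.h c i}
      zero_mem' := ⟨0, by simp, by simp⟩
      add_mem' := by
        rintro _ _ ⟨a, ha, rfl⟩ ⟨b, hb, rfl⟩
        refine ⟨a + b, fun i hi u hu => ?_, ?_⟩
        · rcases Finset.mem_union.1 (MvPolynomial.support_add hu) with h | h
          · exact ha i hi u h
          · exact hb i hi u h
        · simp [add_mul, Finset.sum_add_distrib] }
  have single : ∀ i ≤ E.s, ∀ a : MvPolynomial (Fin 2) R,
      (i < E.s → ∀ u ∈ a.support, u 1 < E.d (i + 1)) → a * E.h c i ∈ S := by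
    intro i hi a ha
    refine ⟨Pi.single i a, fun k hk u hu => ?_, ?_⟩
    · by_cases hki : k = i
      · subst hki; rw [Pi.single_eq_same] at hu; exact ha hk u hu
      · rw [Pi.single_eq_of_ne hki] at hu; simp at hu
    · rw [Finset.sum_eq_single i]
      · rw [Pi.single_eq_same]
      · intro k _ hki; rw [Pi.single_eq_of_ne hki, zero_mul]
      · intro hn; exact absurd (Finset.mem_range.2 (by omega)) hn
  have key : ∀ k i, E.s - i = k → i ≤ E.s → ∀ a, a * E.h c i ∈ S := by
    intro k
    induction k using Nat.strong_induction_on with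
    | _ k ih =>
    intro i hk hi a
    rcases hi.eq_or_lt with rfl | hi
    · exact single _ le_rfl a (fun h => absurd h (lt_irrefl _))
    · obtain ⟨q, r, hqr, -, hr⟩ := lexYX.div_single (b := E.D c (i + 1))
        (by rw [(monic_D c i).1.leadingCoeff_eq_one]; exact isUnit_one) a
      have h1 : a * E.h c i = r * E.h c i + ((q * varY R ^ E.e (i + 1)) * E.h c (i + 1) +
          ∑ j ∈ Finset.Ioc i E.s, (q * E.sigma c j i) * E.h c j) := by
        have := D_mul_h c hi
        have h2 : ∑ j ∈ Finset.Ioc i E.s, (q * E.sigma c j i) * E.h c j =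
            q * ∑ j ∈ Finset.Ioc i E.s, E.sigma c j i * E.h c j := by
          rw [Finset.mul_sum]; exact Finset.sum_congr rfl fun j _ => mul_assoc _ _ _
        rw [hqr, h2]
        linear_combination q * this
      rw [h1]
      refine add_mem (single i hi.le r fun _ u hu => ?_)
        (add_mem (ih (E.s - (i + 1)) (by omega) (i + 1) rfl (by omega) _)
          (sum_mem fun j hj => ?_))
      · have := hr u hu
        rw [(monic_D c i).2, Finsupp.single_le_iff] at this
        omega
      · have := Finset.mem_Ioc.1 hj
        exact ih (E.s - j) (by omega) j rfl (by omega) _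
  change p ∈ S
  have all : ∀ b, b * p ∈ S := by
    refine Submodule.span_induction (p := fun x _ => ∀ b, b * x ∈ S) ?_ ?_ ?_ ?_ hp
    · rintro x ⟨i, hi, rfl⟩ b
      exact key _ i rfl hi b
    · intro b; rw [mul_zero]; exact zero_mem S
    · intro x y _ _ hx hy b; rw [mul_add]; exact add_mem (hx b) (hy b)
    · intro a x _ hx b; rw [smul_eq_mul, ← mul_assoc]; exact hx _
  simpa using all 1

theorem eq_zero_of_mem_idealOf (c : E.Param → R) {r : MvPolynomial (Fin 2) R}
    (hr : r ∈ E.idealOf c) (hs : (r.support : Set (Fin 2 →₀ ℕ)) ⊆ E.seg) : r = 0 := by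
  classical
  cases subsingleton_or_nontrivial R
  · exact Subsingleton.elim _ _
  obtain ⟨a, ha, hra⟩ := exists_normal_combination c hr
  by_contra hr0
  let A := (Finset.range (E.s + 1)).filter fun i => a i ≠ 0
  have hA : A.Nonempty := by
    by_contra hA
    rw [Finset.not_nonempty_iff_eq_empty, Finset.filter_eq_empty_iff] at hA
    refine hr0 (hra.trans (Finset.sum_eq_zero fun i hi => ?_))
    rw [not_not.1 (hA hi), zero_mul]
  have hdeg : ∀ i ≤ E.s, a i ≠ 0 → lexYX.degree (a i * E.h c i) = lexYX.degree (a i) + E.expo i := by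
    intro i hi hai
    rw [← (monic_h c hi).2]
    exact lexYX.degree_mul_of_right_mem_nonZeroDivisors hai
      (by rw [(monic_h c hi).1.leadingCoeff_eq_one]; exact one_mem _)
  obtain ⟨i, hiA, hmax⟩ := A.exists_max_image
    (fun i => lexYX.toSyn (lexYX.degree (a i) + E.expo i)) hA
  have hi : i ≤ E.s := by
    have := Finset.mem_range.1 (Finset.mem_filter.1 hiA).1; omega
  have hai : a i ≠ 0 := (Finset.mem_filter.1 hiA).2
  have hx : ∀ k ≤ E.s, (lexYX.degree (a k) + E.expo k) 1 = lexYX.degree (a k) 1 + E.m k := by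
    intro k _; simp [expo]
  have hne : ∀ k ≤ E.s, ∀ l ≤ E.s, k < l → a k ≠ 0 →
      (lexYX.degree (a k) + E.expo k) 1 < (lexYX.degree (a l) + E.expo l) 1 := by
    intro k hk l hl hkl hak
    rw [hx k hk, hx l hl]
    have h1 := ha k (by omega) _ (lexYX.degree_mem_support hak)
    have h2 := m_add_d (E := E) (i := k) (by omega)
    have h3 := m_mono (E := E) (i := k + 1) (j := l) hkl hl
    omega
  have hcoeff : coeff (lexYX.degree (a i) + E.expo i) r = lexYX.leadingCoeff (a i) := by
    rw [hra, coeff_sum, Finset.sum_eq_single i]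
    · conv_lhs => rw [← (monic_h c hi).2]
      rw [lexYX.coeff_mul_of_degree_add, (monic_h c hi).1.leadingCoeff_eq_one, mul_one]
    · intro k hk hki
      have hk : k ≤ E.s := by have := Finset.mem_range.1 hk; omega
      by_cases hak : a k = 0
      · rw [hak, zero_mul, coeff_zero]
      · refine lexYX.coeff_eq_zero_of_lt ?_
        rw [hdeg k hk hak]
        refine lt_of_le_of_ne (hmax k (Finset.mem_filter.2 ⟨Finset.mem_range.2 (by omega), hak⟩))
          fun heq => ?_
        have heq := DFunLike.congr_fun (lexYX.toSyn.injective heq) 1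
        rcases lt_or_gt_of_ne hki with hlt | hlt
        · exact absurd heq (hne k hk i hi hlt hak).ne
        · exact absurd heq (hne i hi k hk hlt hai).ne'
    · intro hn; exact absurd (Finset.mem_range.2 (by omega)) hn
  have hmem : lexYX.degree (a i) + E.expo i ∈ r.support := by
    rw [mem_support_iff, hcoeff]
    exact lexYX.leadingCoeff_ne_zero_iff.2 hai
  exact hs hmem i hi le_add_self

theorem existsUnique_isRemainder (c : E.Param → R) (f : MvPolynomial (Fin 2) R) :
    ∃! r, E.IsRemainder c f r := by
  classical
  obtain ⟨r, hr⟩ := exists_isRemainder c f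
  refine ⟨r, hr, fun r' hr' => sub_eq_zero.1 (eq_zero_of_mem_idealOf c ?_ fun u hu => ?_)⟩
  · have := sub_mem hr.1 hr'.1
    rwa [sub_sub_sub_cancel_left] at this
  · rcases Finset.mem_union.1 (MvPolynomial.support_sub _ _ _ hu) with h | h
    · exact hr'.2 h
    · exact hr.2 h

theorem map_sigma {S : Type*} [CommRing S] (φ : R →+* S) (c : E.Param → R) (j i : ℕ) :
    map φ (E.sigma c j i) = E.sigma (fun p => φ (c p)) j i := by
  simp only [sigma, map_sum, apply_ite (map φ), map_mul, map_pow, map_C, map_X, map_zero]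

theorem map_D {S : Type*} [CommRing S] (φ : R →+* S) (c : E.Param → R) (i : ℕ) :
    map φ (E.D c i) = E.D (fun p => φ (c p)) i := by
  simp only [D, map_sub, map_pow, map_X, map_sigma]

theorem map_cofactor {S : Type*} [CommRing S] (φ : R →+* S) (c : E.Param → R) {i : ℕ}
    (hi : i ≤ E.s) : map φ (E.cofactor c i) = E.cofactor (fun p => φ (c p)) i := by
  induction hk : E.s - i using Nat.strong_induction_on generalizing i with
  | _ k ih =>
  rcases hi.eq_or_lt with rfl | hi
  · rw [cofactor_last, cofactor_last, map_one]
  · rw [cofactor_step c hi, cofactor_step _ hi]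
    simp only [map_add, map_mul, map_pow, map_X, map_sum, map_prod, map_sigma, map_D]
    rw [ih (E.s - (i + 1)) (by omega) (i := i + 1) (by omega) rfl]
    congr 1
    refine Finset.sum_congr rfl fun j hj => ?_
    have := Finset.mem_Ioc.1 hj
    rw [ih (E.s - j) (by omega) (i := j) (by omega) rfl]

theorem map_h {S : Type*} [CommRing S] (φ : R →+* S) (c : E.Param → R) {i : ℕ} (hi : i ≤ E.s) :
    map φ (E.h c i) = E.h (fun p => φ (c p)) i := by
  simp only [h, map_mul, map_prod, map_D, map_cofactor φ c hi]

/-- Remainders commute with ring homomorphisms.  For instance, the remainder over the polynomial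
ring `K[Λ]` is the remainder over the fraction field `K(Λ)`. -/
theorem IsRemainder.map {S : Type*} [CommRing S] (φ : R →+* S) {c : E.Param → R}
    {f r : MvPolynomial (Fin 2) R} (hr : E.IsRemainder c f r) :
    E.IsRemainder (fun p => φ (c p)) (MvPolynomial.map φ f) (MvPolynomial.map φ r) := by
  refine ⟨?_, fun u hu => hr.2 (support_map_subset _ _ hu)⟩
  rw [← map_sub]
  have h1 : (E.idealOf c).map (MvPolynomial.map φ) ≤ E.idealOf (fun p => φ (c p)) := by
    rw [idealOf, Ideal.map_span, Ideal.span_le]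
    rintro _ ⟨_, ⟨i, hi, rfl⟩, rfl⟩
    rw [map_h φ c hi]
    exact h_mem _ hi
  exact h1 (Ideal.mem_map_of_mem _ hr.1)

end facts

/-- The remainder of `f` modulo the Gröbner basis with parameters `c`. -/
noncomputable def rem (c : E.Param → R) (f : MvPolynomial (Fin 2) R) : MvPolynomial (Fin 2) R :=
  (existsUnique_isRemainder c f).choose

theorem isRemainder_rem (c : E.Param → R) (f : MvPolynomial (Fin 2) R) :
    E.IsRemainder c f (E.rem c f) :=
  (existsUnique_isRemainder c f).choose_spec.1

variable {K : Type*} [Field K]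

/-- The polynomial `𝓔 = 𝓝_μ(f)` in `K[Λ]`: the coefficient of `x ^ μ 1 * y ^ μ 0` in the remainder
of `f` modulo the Gröbner basis whose parameters are the indeterminates `Λ`. -/
noncomputable def equation (f : MvPolynomial (Fin 2) K) (μ : E.seg) : MvPolynomial E.Param K :=
  coeff μ.1 (E.rem (X : E.Param → MvPolynomial E.Param K) (map C f))

open Classical in
/-- The polynomial `𝓕` obtained from `𝓔` by setting to zero the indeterminates that are not punctual
parameters. -/
noncomputable def punctualEquation (f : MvPolynomial (Fin 2) K) (μ : E.seg) :
    MvPolynomial E.PunctualParam K :=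
  aeval (fun p : E.Param => if hp : E.IsPunctual p then X (⟨p, hp⟩ : E.PunctualParam) else 0)
    (E.equation f μ)

end Staircase

/-- The ideal of the polynomials that vanish at the point `a`. -/
noncomputable def pointIdeal {K ι : Type*} [Field K] (a : ι → K) : Ideal (MvPolynomial ι K) :=
  RingHom.ker (eval a)

instance {K ι : Type*} [Field K] (a : ι → K) : (pointIdeal a).IsPrime :=
  RingHom.ker_isPrime (eval a)

/-- The multiplicity of the `K`-rational point `a` as a solution of the equations of the ideal `Q`:
the dimension of the local ring of `K[X] / Q` at `a`. -/
noncomputable def solutionMultiplicity {K ι : Type*} [Field K] (Q : Ideal (MvPolynomial ι K))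
    (a : ι → K) : ℕ :=
  Module.finrank K (Localization.AtPrime (pointIdeal a) ⧸
    Q.map (algebraMap (MvPolynomial ι K) (Localization.AtPrime (pointIdeal a))))

/-! ### Uniqueness of the Gröbner parameters over an arbitrary ring -/

namespace Staircase

variable {E : Staircase} {R : Type*} [CommRing R]

/-! The punctual equations have a functorial meaning. Remainders commute with base change, so for
every commutative ring `R` a homomorphism `φ` from `K[Λ]` (punctual indeterminates) to `R` kills all
the equations of `f` exactly when `f`, read over `R`, lies in the ideal with punctual parameters `φ
(Λ)` (`punctualEquation_eq_zero_iff`). It therefore suffices to show that over any `R` the only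
punctual parameters `c` with `J ⊆ idealOf c` are the images of the parameters `lam` of `I`. Taking
for `R` the quotient of `K[Λ]` by the equations, where nilpotents are allowed, gives `Λ p = lam p`
in that quotient. Hence the equations generate the whole ideal of the point, and maximality,
uniqueness of the solution and both forms of simplicity follow formally.

The rigidity statement is `eq_of_map_le`. If `c` is punctual, then `h s` is a power of `x` and `h 0`
is a power of `y` modulo `x`, so some power `P ^ n` of `P = ⟨x, y⟩` lies in `idealOf c`
(`span_le_radical`). Since `I ⊆ P` and `I + I' = 1`, one has `I ⊆ I * I' + P ^ n = J + P ^ n`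
(`le_mul_sup_pow`). Thus containing `J` forces `idealOf c` to contain `I`, that is, the ideal with
parameters `lam`. When the diagonal `σ_{i, i}` vanish, an inclusion of two such ideals already
forces equal parameters, over any ring (`eq_of_idealOf_le`). This follows by descending induction on
`i`, from an analysis of leading exponents in `combination_eq_zero`.

There remain the parameters of `I` itself. They exist because `I` contains a power of `x`
(`exists_params`). Those that are not punctual vanish because `I` contains powers of `x` and `y`:
divisors of a power of a variable are monomials (`diagZero_of_mem`,
`DiagZero.eq_zero_of_not_punctual`). -/

theorem expo_zero (i : ℕ) : E.expo i 0 = E.n i := by simp [expo]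

theorem expo_one (i : ℕ) : E.expo i 1 = E.m i := by simp [expo]

theorem le_iff_fin_two {u v : Fin 2 →₀ ℕ} : u ≤ v ↔ u 0 ≤ v 0 ∧ u 1 ≤ v 1 := by
  rw [Finsupp.le_def, Fin.forall_fin_two]

/-- The leading exponent of a nonzero element of `⟨h 0, …, h s⟩` lies above some `expo i`. -/
theorem exists_expo_le_degree [Nontrivial R] (c : E.Param → R) {r : MvPolynomial (Fin 2) R}
    (hr : r ∈ E.idealOf c) (hr0 : r ≠ 0) : ∃ i ≤ E.s, E.expo i ≤ lexYX.degree r := by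
  classical
  obtain ⟨g, q, hf, hdeg, hq⟩ := lexYX.div (b := fun i : Fin (E.s + 1) => E.h c i)
    (fun i => by
      rw [(monic_h c (Nat.lt_succ_iff.1 i.2)).1.leadingCoeff_eq_one]; exact isUnit_one) r
  rw [Finsupp.linearCombination_apply] at hf
  -- The remainder of an element of the ideal is itself an element of the ideal supported off the
  -- staircase.
  have hq0 : q = 0 := by
    refine eq_zero_of_mem_idealOf c ?_ fun u hu i hi => ?_
    · rw [eq_sub_of_add_eq' hf.symm]
      exact sub_mem hr (sum_mem fun i _ =>
        Ideal.mul_mem_left _ _ (h_mem c (Nat.lt_succ_iff.1 i.2)))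
    · have := hq u hu ⟨i, Nat.lt_succ_iff.2 hi⟩
      rwa [(monic_h c hi).2] at this
  rw [hq0, add_zero] at hf
  have hmem : lexYX.degree r ∈ (∑ i ∈ g.support, g i • E.h c i).support := by
    change lexYX.degree r ∈ (g.sum fun i a => a • E.h c i).support
    rw [← hf]
    exact lexYX.degree_mem_support hr0
  obtain ⟨i, -, hi⟩ := Finset.mem_biUnion.1 (MvPolynomial.support_sum hmem)
  have his := Nat.lt_succ_iff.1 i.2
  refine ⟨i, his, ?_⟩
  rw [smul_eq_mul, mul_comm] at hi
  -- No summand of the division exceeds the degree of `r`, so a summand in which this exponent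
  -- occurs has it as leading exponent.
  have heq : lexYX.degree (E.h c i * g i) = lexYX.degree r :=
    lexYX.toSyn.injective (le_antisymm (hdeg i) (lexYX.le_degree hi))
  rw [← heq, lexYX.degree_mul_of_left_mem_nonZeroDivisors
    (by rw [(monic_h c his).1.leadingCoeff_eq_one]; exact one_mem _)
    (by rintro h0; rw [h0, mul_zero] at hi; simp at hi), (monic_h c his).2]
  exact le_self_add

/-- Distinct parameters of the same `σ` sit at distinct monomials. This lets equalities between the
polynomials `σ` be read as equalities between parameters. -/
theorem coeff_sigma (c : E.Param → R) (p : E.Param) :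
    coeff (Finsupp.single 0 p.b + Finsupp.single 1 p.a) (E.sigma c p.j p.i) = c p := by
  classical
  have h1 : ∀ q : E.Param, C (c q) * varX R ^ q.a * varY R ^ q.b =
      monomial (Finsupp.single 0 q.b + Finsupp.single 1 q.a) (c q) := by
    intro q
    rw [X_pow_eq_monomial, X_pow_eq_monomial, C_mul_monomial, monomial_mul, mul_one, mul_one,
      add_comm]
  rw [sigma, coeff_sum, Finset.sum_eq_single p]
  · rw [if_pos ⟨rfl, rfl⟩, h1, coeff_monomial, if_pos rfl]
  · intro q _ hqp
    split_ifs with hq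
    · rw [h1, coeff_monomial, if_neg]
      intro heq
      have ha := DFunLike.congr_fun heq 1
      have hb := DFunLike.congr_fun heq 0
      simp at ha hb
      apply hqp
      obtain ⟨qi, qj, qa, qb, _⟩ := q
      obtain ⟨pi, pj, pa, pb, _⟩ := p
      obtain ⟨h1, h2⟩ := hq
      simp only at h1 h2 ha hb
      subst h1 h2 ha hb
      rfl
    · exact coeff_zero _
  · intro hp; exact absurd (Finset.mem_univ _) hp

theorem sigma_eq_zero_of {c : E.Param → R} {i j : ℕ}
    (hc : ∀ p : E.Param, p.i = i → p.j = j → c p = 0) : E.sigma c j i = 0 := by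
  refine Finset.sum_eq_zero fun p _ => ?_
  split_ifs with hp
  · rw [hc p hp.1 hp.2, C_0, zero_mul, zero_mul]
  · rfl

/-- The parameters with all `σ_{i, i}` equal to zero. -/
def DiagZero (c : E.Param → R) : Prop := ∀ p : E.Param, p.j = p.i → c p = 0

theorem DiagZero.sigma_self {c : E.Param → R} (hc : DiagZero c) (i : ℕ) : E.sigma c i i = 0 :=
  sigma_eq_zero_of fun p hi hj => hc p (hj.trans hi.symm)

theorem DiagZero.D_eq {c : E.Param → R} (hc : DiagZero c) (i : ℕ) :
    E.D c i = varX R ^ E.d i := by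
  rw [D, hc.sigma_self, sub_zero]

theorem DiagZero.prod_D {c : E.Param → R} (hc : DiagZero c) {i : ℕ} (hi : i ≤ E.s) :
    ∏ k ∈ Finset.Icc 1 i, E.D c k = varX R ^ E.m i := by
  induction i with
  | zero => simp [E.m_zero]
  | succ i ih =>
    rw [Finset.prod_Icc_succ_top (by omega), ih (by omega), hc.D_eq, ← pow_add, m_add_d hi]

theorem DiagZero.h_eq {c : E.Param → R} (hc : DiagZero c) {i : ℕ} (hi : i ≤ E.s) :
    E.h c i = varX R ^ E.m i * E.cofactor c i := by
  rw [h, hc.prod_D hi]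

theorem DiagZero.h_last {c : E.Param → R} (hc : DiagZero c) :
    E.h c E.s = varX R ^ E.m E.s := by
  rw [hc.h_eq le_rfl, cofactor_last, mul_one]

theorem varX_pow_eq (n : ℕ) : varX R ^ n = monomial (Finsupp.single 1 n) 1 :=
  X_pow_eq_monomial

theorem varY_pow_eq (n : ℕ) : varY R ^ n = monomial (Finsupp.single 0 n) 1 :=
  X_pow_eq_monomial

/-- If `x ^ d (i + 1) * g` is a combination of the `h j` for `j > i` whose coefficients satisfy the
degree bounds of the Gröbner parameters, and `g` lies in the ideal, then the combination is
trivial. -/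
theorem combination_eq_zero [Nontrivial R] (c : E.Param → R) {i : ℕ}
    {g : MvPolynomial (Fin 2) R} (hg : g ∈ E.idealOf c) (τ : ℕ → MvPolynomial (Fin 2) R)
    (hτ : ∀ j ∈ Finset.Ioc i E.s, ∀ u ∈ (τ j).support, u 1 < E.d (i + 1) ∧ u 0 < E.e j)
    (heq : varX R ^ E.d (i + 1) * g = ∑ j ∈ Finset.Ioc i E.s, τ j * E.h c j) :
    ∀ j ∈ Finset.Ioc i E.s, τ j = 0 := by
  classical
  by_contra! hex
  -- The bounds put the `y`-degree of the leading term of `τ j * h j` in the band from `n j` to `n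
  -- (j - 1)`, upper end excluded. These bands are disjoint, so the nonzero term with smallest `j`
  -- dominates.
  obtain ⟨j, ⟨hj, hτj⟩, hmin⟩ : ∃ j, (j ∈ Finset.Ioc i E.s ∧ τ j ≠ 0) ∧
      ∀ k ∈ Finset.Ioc i E.s, k < j → τ k = 0 := by
    refine ⟨Nat.find hex, Nat.find_spec hex, fun k hk hkj => ?_⟩
    by_contra h0
    exact Nat.find_min hex hkj ⟨hk, h0⟩
  obtain ⟨hij, hjs⟩ := Finset.mem_Ioc.1 hj
  obtain ⟨l, rfl⟩ : ∃ l, j = l + 1 := ⟨j - 1, by omega⟩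
  have hne := n_add_e (E := E) (i := l) (by omega)
  set u := lexYX.degree (τ (l + 1)) + E.expo (l + 1) with hu
  have hτd := hτ _ hj _ (lexYX.degree_mem_support hτj)
  have hu0 : u 0 < E.n l ∧ E.n (l + 1) ≤ u 0 := by
    rw [hu, Finsupp.add_apply, expo_zero]; omega
  have hu1 : u 1 < E.d (i + 1) + E.m (l + 1) := by
    rw [hu, Finsupp.add_apply, expo_one]; omega
  have hdeg : ∀ k ≤ E.s, lexYX.toSyn (lexYX.degree (τ k * E.h c k)) ≤
      lexYX.toSyn (lexYX.degree (τ k) + E.expo k) := by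
    intro k hk
    rw [← (monic_h c hk).2]
    exact lexYX.degree_mul_le
  have hlt : ∀ k ∈ Finset.Ioc i E.s, l + 1 < k → τ k ≠ 0 → ∀ v ∈ (τ k * E.h c k).support,
      lexYX.toSyn v < lexYX.toSyn u := by
    intro k hk hlk hτk v hv
    obtain ⟨k, rfl⟩ : ∃ k', k = k' + 1 := ⟨k - 1, by omega⟩
    have hks := (Finset.mem_Ioc.1 hk).2
    refine ((lexYX.le_degree hv).trans (hdeg _ hks)).trans_lt (lex_lt_of_zero ?_)
    have h1 := (hτ _ hk _ (lexYX.degree_mem_support hτk)).2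
    have h2 := n_add_e (E := E) (i := k) (by omega)
    have h3 := n_anti (E := E) (i := l + 1) (j := k) (by omega) (by omega)
    rw [Finsupp.add_apply, expo_zero]
    omega
  have hle : ∀ v ∈ (varX R ^ E.d (i + 1) * g).support, lexYX.toSyn v ≤ lexYX.toSyn u := by
    intro v hv
    rw [heq] at hv
    obtain ⟨k, hk, hv⟩ := Finset.mem_biUnion.1 (MvPolynomial.support_sum hv)
    have hτk : τ k ≠ 0 := by rintro h0; rw [h0, zero_mul] at hv; simp at hv
    rcases lt_trichotomy k (l + 1) with h1 | rfl | h1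
    · exact absurd (hmin k hk h1) hτk
    · exact (lexYX.le_degree hv).trans (hdeg _ hjs)
    · exact (hlt k hk h1 hτk v hv).le
  have hcoeff : coeff u (varX R ^ E.d (i + 1) * g) ≠ 0 := by
    rw [heq, coeff_sum, Finset.sum_eq_single (l + 1)]
    · rw [hu, ← (monic_h c hjs).2, lexYX.coeff_mul_of_degree_add,
        (monic_h c hjs).1.leadingCoeff_eq_one, mul_one]
      exact lexYX.leadingCoeff_ne_zero_iff.2 hτj
    · intro k hk hkl
      by_contra h0
      have hτk : τ k ≠ 0 := by rintro h1; rw [h1, zero_mul] at h0; simp at h0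
      rcases lt_or_gt_of_ne hkl with h1 | h1
      · exact hτk (hmin k hk h1)
      · exact absurd (hlt k hk h1 hτk u (mem_support_iff.2 h0)) (lt_irrefl _)
    · intro h0; exact absurd hj h0
  rw [varX_pow_eq, coeff_monomial_mul'] at hcoeff
  split_ifs at hcoeff with hsu
  swap
  · exact hcoeff rfl
  rw [one_mul] at hcoeff
  set w := u - Finsupp.single 1 (E.d (i + 1)) with hw
  have hg0 : g ≠ 0 := by rintro h0; rw [h0] at hcoeff; simp at hcoeff
  have hwu : w + Finsupp.single 1 (E.d (i + 1)) = u := tsub_add_cancel_of_le hsu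
  have hdw : lexYX.degree g = w := by
    refine lexYX.toSyn.injective (le_antisymm ?_ (lexYX.le_degree (mem_support_iff.2 hcoeff)))
    have h1 : lexYX.degree g + Finsupp.single 1 (E.d (i + 1)) ∈
        (varX R ^ E.d (i + 1) * g).support := by
      rw [mem_support_iff, varX_pow_eq, add_comm, coeff_monomial_mul, one_mul]
      exact lexYX.leadingCoeff_ne_zero_iff.2 hg0
    have h2 := hle _ h1
    rw [← hwu, map_add, map_add] at h2
    exact le_of_add_le_add_right h2
  -- The contradiction: `w` has `y`-degree less than `n l`, so only `expo k` with `k > l` can lie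
  -- below it. But its `x`-degree is less than `m (l + 1)`, because the factor `x ^ d (i + 1)` has
  -- been removed from `u`.
  obtain ⟨k, hk, hkw⟩ := exists_expo_le_degree c hg hg0
  rw [hdw, le_iff_fin_two, expo_zero, expo_one] at hkw
  have hw0 := DFunLike.congr_fun hwu 0
  have hw1 := DFunLike.congr_fun hwu 1
  simp at hw0 hw1
  rcases Nat.lt_or_ge l k with hlk | hlk
  · have := m_mono (E := E) (i := l + 1) (j := k) hlk hk
    omega
  · have := n_anti (E := E) (i := k) (j := l) hlk (by omega)
    omega

theorem eq_zero_of_varX_pow_mul [Nontrivial R] {n : ℕ} {g : MvPolynomial (Fin 2) R}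
    (hg : varX R ^ n * g = 0) : g = 0 := by
  rw [varX_pow_eq] at hg
  ext u
  have := congrArg (coeff (Finsupp.single 1 n + u)) hg
  rwa [coeff_monomial_mul, one_mul, coeff_zero] at this

/-- Over any ring, the Gröbner parameters with vanishing `σ_{i, i}` are determined by the ideal. -/
theorem eq_of_idealOf_le {c c' : E.Param → R} (hc : DiagZero c) (hc' : DiagZero c')
    (hle : E.idealOf c ≤ E.idealOf c') : c = c' := by
  cases subsingleton_or_nontrivial R
  · exact Subsingleton.elim _ _
  have key : ∀ k i, E.s - i = k → i ≤ E.s → E.h c i = E.h c' i ∧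
      (i < E.s → ∀ j ∈ Finset.Ioc i E.s, E.sigma c j i = E.sigma c' j i) := by
    intro k
    induction k using Nat.strong_induction_on with
    | _ k ih =>
    intro i hk hi
    rcases hi.eq_or_lt with rfl | hi
    · exact ⟨by rw [hc.h_last, hc'.h_last], fun h => absurd h (lt_irrefl _)⟩
    have hj : ∀ j ∈ Finset.Ioc i E.s, E.h c j = E.h c' j := fun j hj => by
      have := Finset.mem_Ioc.1 hj
      exact (ih (E.s - j) (by omega) j rfl (by omega)).1
    have h1 := D_mul_h c hi
    have h2 := D_mul_h c' hi
    rw [hc.D_eq, hj (i + 1) (Finset.mem_Ioc.2 ⟨by omega, by omega⟩)] at h1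
    rw [hc'.D_eq] at h2
    -- By induction the later basis elements agree, so subtracting the two syzygies leaves only
    -- differences of the `σ`, which obey the same degree bounds.
    have h3 : varX R ^ E.d (i + 1) * (E.h c i - E.h c' i) =
        ∑ j ∈ Finset.Ioc i E.s, (E.sigma c j i - E.sigma c' j i) * E.h c' j := by
      rw [mul_sub, h1, h2, add_sub_add_left_eq_sub, ← Finset.sum_sub_distrib]
      exact Finset.sum_congr rfl fun j hj' => by rw [hj j hj', sub_mul]
    have h4 := combination_eq_zero c' (sub_mem (hle (h_mem c hi.le)) (h_mem c' hi.le)) _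
      (fun j hj u hu => by
        classical
        have hij := (Finset.mem_Ioc.1 hj).1
        rcases Finset.mem_union.1 (MvPolynomial.support_sub _ _ _ hu) with h | h <;>
        · have := support_sigma _ h
          rwa [if_neg (by omega)] at this) h3
    refine ⟨?_, fun _ j hj => sub_eq_zero.1 (h4 j hj)⟩
    rw [Finset.sum_eq_zero fun j hj => by rw [h4 j hj, zero_mul]] at h3
    exact sub_eq_zero.1 (eq_zero_of_varX_pow_mul h3)
  funext p
  rcases p.hij.eq_or_lt with hp | hp
  · rw [hc p hp.symm, hc' p hp.symm]
  · rw [← coeff_sigma c p, ← coeff_sigma c' p,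
      (key _ p.i rfl p.hi.le).2 p.hi p.j (Finset.mem_Ioc.2 ⟨hp, p.hj⟩)]

end Staircase

/-! ### Existence of the Gröbner parameters over a field -/

namespace Staircase

variable {E : Staircase} {R : Type*} [CommRing R]

variable (R) in
/-- The polynomials of `y`-degree less than `n`. -/
noncomputable def yLow (n : ℕ) : Submodule R (MvPolynomial (Fin 2) R) :=
  restrictSupport R {u | u 0 < n}

theorem mem_yLow {n : ℕ} {p : MvPolynomial (Fin 2) R} :
    p ∈ yLow R n ↔ ∀ u ∈ p.support, u 0 < n := Iff.rfl

theorem yLow_mono {a b : ℕ} (hab : a ≤ b) : yLow R a ≤ yLow R b :=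
  restrictSupport_mono R fun _ hu => lt_of_lt_of_le hu hab

theorem monomial_mem_yLow {n : ℕ} {u : Fin 2 →₀ ℕ} (hu : u 0 < n) (r : R) :
    monomial u r ∈ yLow R n :=
  (monomial_mem_restrictSupport R).2 (Or.inl hu)

/-- The bounds are asymmetric on purpose: `y`-degree at most `a` times `y`-degree less than `b`
gives exactly less than `a + b`. -/
theorem mul_mem_yLow {a b : ℕ} {p q : MvPolynomial (Fin 2) R} (hp : p ∈ yLow R (a + 1))
    (hq : q ∈ yLow R b) : p * q ∈ yLow R (a + b) := by
  classical
  intro u hu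
  obtain ⟨v, hv, w, hw, rfl⟩ := Finset.mem_add.1 (support_mul p q hu)
  have h1 : v 0 < a + 1 := hp hv
  have h2 : w 0 < b := hq hw
  change v 0 + w 0 < a + b
  omega

theorem aeval_varX_mem_yLow (A : Polynomial R) : Polynomial.aeval (varX R) A ∈ yLow R 1 := by
  rw [Polynomial.aeval_eq_sum_range]
  refine sum_mem fun k _ => Submodule.smul_mem _ _ ?_
  rw [varX_pow_eq]
  exact monomial_mem_yLow (by simp) _

theorem eq_single_add_single (u : Fin 2 →₀ ℕ) :
    u = Finsupp.single 0 (u 0) + Finsupp.single 1 (u 1) := by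
  ext i
  fin_cases i <;> simp

theorem varX_pow_mul_varY_pow (a b : ℕ) :
    varX R ^ a * varY R ^ b = monomial (Finsupp.single 0 b + Finsupp.single 1 a) 1 := by
  rw [varX_pow_eq, varY_pow_eq, monomial_mul, one_mul, add_comm]

variable {K : Type*} [Field K] {I : Ideal (MvPolynomial (Fin 2) K)}

theorem exists_expo_le_degree_of_mem (hE : initialIdeal I = E.monomialIdeal K)
    {f : MvPolynomial (Fin 2) K} (hf : f ∈ I) (hf0 : f ≠ 0) :
    ∃ i ≤ E.s, E.expo i ≤ lexYX.degree f := by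
  classical
  have h1 : lexYX.leadingTerm f ∈ E.monomialIdeal K := by
    rw [← hE]; exact Ideal.subset_span ⟨f, hf, rfl⟩
  have h2 : E.monomialIdeal K =
      Ideal.span ((fun u => monomial u (1 : K)) '' {u | ∃ i ≤ E.s, u = E.expo i}) := by
    rw [monomialIdeal]
    congr 1
    ext p
    constructor
    · rintro ⟨i, hi, rfl⟩; exact ⟨_, ⟨i, hi, rfl⟩, rfl⟩
    · rintro ⟨_, ⟨i, hi, rfl⟩, rfl⟩; exact ⟨i, hi, rfl⟩
  rw [h2, mem_ideal_span_monomial_image] at h1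
  obtain ⟨_, ⟨i, hi, rfl⟩, h3⟩ := h1 (lexYX.degree f) (by
    rw [MonomialOrder.support_leadingTerm' hf0]; exact Finset.mem_singleton_self _)
  exact ⟨i, hi, h3⟩

/-- Some leading exponent of `I` lies below `expo i`; a monomial multiple then attains it exactly.
-/
theorem exists_mem_degree_eq_expo (hE : initialIdeal I = E.monomialIdeal K) {i : ℕ}
    (hi : i ≤ E.s) : ∃ f ∈ I, f ≠ 0 ∧ lexYX.degree f = E.expo i := by
  classical
  have h1 : monomial (E.expo i) (1 : K) ∈ initialIdeal I := by
    rw [hE]; exact Ideal.subset_span ⟨i, hi, rfl⟩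
  rw [initialIdeal, MonomialOrder.span_leadingTerm_eq_span_monomial',
    ← Set.image_image (fun u => monomial u (1 : K)), mem_ideal_span_monomial_image] at h1
  obtain ⟨_, ⟨f, ⟨hf, hf0⟩, rfl⟩, hle⟩ := h1 (E.expo i) (by simp)
  have hm : monomial (E.expo i - lexYX.degree f) (1 : K) ≠ 0 := by simp
  refine ⟨monomial (E.expo i - lexYX.degree f) 1 * f, I.mul_mem_left _ hf, mul_ne_zero hm hf0, ?_⟩
  rw [lexYX.degree_mul hm hf0, lexYX.degree_monomial, if_neg one_ne_zero,
    tsub_add_cancel_of_le hle]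

/-- The polynomials in `x` that are the coefficient of `y ^ n` of an element of `I` of `y`-degree
at most `n`. -/
noncomputable def topCoeffIdeal (I : Ideal (MvPolynomial (Fin 2) K)) (n : ℕ) :
    Ideal (Polynomial K) where
  carrier := {A | ∃ q ∈ I, q - Polynomial.aeval (varX K) A * varY K ^ n ∈ yLow K n}
  zero_mem' := ⟨0, I.zero_mem, by simp⟩
  add_mem' := by
    rintro A B ⟨p, hp, hA⟩ ⟨q, hq, hB⟩
    refine ⟨p + q, I.add_mem hp hq, ?_⟩
    rw [map_add, add_mul, add_sub_add_comm]
    exact add_mem hA hB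
  smul_mem' := by
    rintro B A ⟨p, hp, hA⟩
    refine ⟨Polynomial.aeval (varX K) B * p, I.mul_mem_left _ hp, ?_⟩
    rw [smul_eq_mul, map_mul, mul_assoc, ← mul_sub]
    simpa using mul_mem_yLow (a := 0) (aeval_varX_mem_yLow B) hA

/-- Since `y` dominates, the top `y`-coefficient of `f` is a polynomial in `x` whose degree is the
`x`-exponent of the leading term. -/
theorem exists_mem_topCoeffIdeal {f : MvPolynomial (Fin 2) K} (hf : f ∈ I) (hf0 : f ≠ 0) :
    ∃ A ∈ topCoeffIdeal I (lexYX.degree f 0), A.coeff (lexYX.degree f 1) ≠ 0 := by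
  classical
  set n := lexYX.degree f 0 with hn
  set m := lexYX.degree f 1 with hm
  let A : Polynomial K := ∑ k ∈ Finset.range (m + 1),
    Polynomial.monomial k (coeff (Finsupp.single 0 n + Finsupp.single 1 k) f)
  have hA : Polynomial.aeval (varX K) A * varY K ^ n = ∑ k ∈ Finset.range (m + 1),
      monomial (Finsupp.single 0 n + Finsupp.single 1 k)
        (coeff (Finsupp.single 0 n + Finsupp.single 1 k) f) := by
    rw [map_sum, Finset.sum_mul]
    refine Finset.sum_congr rfl fun k _ => ?_
    rw [Polynomial.aeval_monomial, mul_assoc, varX_pow_mul_varY_pow, algebraMap_eq,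
      C_mul_monomial, mul_one]
  refine ⟨A, ⟨f, hf, ?_⟩, ?_⟩
  · rw [mem_yLow, hA]
    intro v hv
    by_contra! hnv
    rw [mem_support_iff, coeff_sub, coeff_sum] at hv
    rcases hnv.eq_or_lt with h0 | h0
    · by_cases hvm : v 1 < m + 1
      · rw [Finset.sum_eq_single (v 1)] at hv
        · rw [h0, ← eq_single_add_single v, coeff_monomial, if_pos rfl, sub_self] at hv
          exact hv rfl
        · intro k _ hk
          rw [coeff_monomial, if_neg]
          rintro rfl
          simp at hk
        · intro h; exact absurd (Finset.mem_range.2 hvm) h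
      · rw [Finset.sum_eq_zero, sub_zero] at hv
        · have h1 := lexYX.le_degree (mem_support_iff.2 hv)
          exact absurd h1 (not_le.2 (lex_lt_of_one h0 (by omega)))
        · intro k hk
          rw [coeff_monomial, if_neg]
          rintro rfl
          have := Finset.mem_range.1 hk
          simp at hvm
          omega
    · rw [Finset.sum_eq_zero, sub_zero] at hv
      · have h1 := zero_le_of_lex_le (lexYX.le_degree (mem_support_iff.2 hv))
        omega
      · intro k hk
        rw [coeff_monomial, if_neg]
        rintro rfl
        simp at h0
  · rw [Polynomial.finsetSum_coeff, Finset.sum_eq_single m]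
    · rw [Polynomial.coeff_monomial, if_pos rfl, hn, hm, ← eq_single_add_single]
      exact lexYX.leadingCoeff_ne_zero_iff.2 hf0
    · intro k _ hk
      rw [Polynomial.coeff_monomial, if_neg hk]
    · intro h; exact absurd (Finset.mem_range.2 (Nat.lt_succ_self _)) h

/-- If a power of `x` lies in `I`, then `I` has elements of the form `x ^ m i * y ^ n i + ⋯`, up to
terms of smaller `y`-degree. -/
theorem exists_mem_sub_mem_yLow (hE : initialIdeal I = E.monomialIdeal K) {M : ℕ}
    (hM : varX K ^ M ∈ I) {i : ℕ} (hi : i ≤ E.s) :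
    ∃ G ∈ I, G - monomial (E.expo i) 1 ∈ yLow K (E.n i) := by
  obtain ⟨f, hf, hf0, hdeg⟩ := exists_mem_degree_eq_expo hE hi
  obtain ⟨A, hA, hA0⟩ := exists_mem_topCoeffIdeal hf hf0
  rw [hdeg, expo_zero] at hA
  rw [hdeg, expo_one] at hA0
  have hXM : (Polynomial.X : Polynomial K) ^ M ∈ topCoeffIdeal I (E.n i) := by
    refine ⟨varX K ^ M * varY K ^ E.n i, I.mul_mem_right _ hM, ?_⟩
    rw [map_pow, Polynomial.aeval_X, sub_self]
    exact zero_mem _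
  obtain ⟨g, hg⟩ : ∃ g, topCoeffIdeal I (E.n i) = Ideal.span {g} :=
    (IsPrincipalIdealRing.principal _).principal
  rw [hg, Ideal.mem_span_singleton] at hXM hA
  -- The generator divides `X ^ M`, so it is a power of `X` up to a unit. The element `A`, with
  -- nonzero coefficient in degree `m i`, bounds that power by `m i`.
  obtain ⟨k, -, hk⟩ := (dvd_prime_pow Polynomial.prime_X _).1 hXM
  have hkm : k ≤ E.m i := by
    by_contra! h
    exact hA0 (Polynomial.X_pow_dvd_iff.1 (hk.symm.dvd.trans hA) _ h)
  have hmem : (Polynomial.X : Polynomial K) ^ E.m i ∈ topCoeffIdeal I (E.n i) := by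
    rw [hg, Ideal.mem_span_singleton]
    exact hk.dvd.trans (pow_dvd_pow _ hkm)
  obtain ⟨G, hG, hlow⟩ := hmem
  refine ⟨G, hG, ?_⟩
  rwa [map_pow, Polynomial.aeval_X, varX_pow_mul_varY_pow] at hlow

theorem lex_le_expo_of_sub_mem_yLow {i : ℕ} {G : MvPolynomial (Fin 2) K}
    (hG : G - monomial (E.expo i) 1 ∈ yLow K (E.n i)) :
    coeff (E.expo i) G = 1 ∧ ∀ u ∈ G.support, u ≠ E.expo i → u 0 < E.n i := by
  classical
  have h : ∀ u ∈ G.support, u ≠ E.expo i → u 0 < E.n i := by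
    intro u hu hne
    refine mem_yLow.1 hG u (mem_support_iff.2 ?_)
    rw [coeff_sub, coeff_monomial, if_neg (Ne.symm hne), sub_zero]
    exact mem_support_iff.1 hu
  refine ⟨?_, h⟩
  by_contra h1
  have h2 : E.expo i ∈ (G - monomial (E.expo i) 1).support := by
    rw [mem_support_iff, coeff_sub, coeff_monomial, if_pos rfl]
    exact sub_ne_zero.2 h1
  have h3 : E.expo i 0 < E.n i := hG h2
  rw [expo_zero] at h3
  exact lt_irrefl _ h3

theorem mem_yLow_succ_of_sub_mem_yLow {i : ℕ} {G : MvPolynomial (Fin 2) K}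
    (hG : G - monomial (E.expo i) 1 ∈ yLow K (E.n i)) : G ∈ yLow K (E.n i + 1) := by
  rw [← sub_add_cancel G (monomial (E.expo i) 1)]
  exact add_mem (yLow_mono (Nat.le_succ _) hG)
    (monomial_mem_yLow (by rw [expo_zero]; exact Nat.lt_succ_self _) _)

/-- An element of `I` of `y`-degree less than `n i` is a combination of the `h j` with `j > i`, with
coefficients of `y`-degree less than `e j`. -/
theorem exists_combination (hE : initialIdeal I = E.monomialIdeal K) {i : ℕ} (hi : i ≤ E.s)
    {h : ℕ → MvPolynomial (Fin 2) K}
    (hh : ∀ j ∈ Finset.Ioc i E.s, h j ∈ I ∧ h j - monomial (E.expo j) 1 ∈ yLow K (E.n j))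
    {p : MvPolynomial (Fin 2) K} (hp : p ∈ I) (hpn : p ∈ yLow K (E.n i)) :
    ∃ τ : ℕ → MvPolynomial (Fin 2) K, (∀ j ∈ Finset.Ioc i E.s, τ j ∈ yLow K (E.e j)) ∧
      p = ∑ j ∈ Finset.Ioc i E.s, τ j * h j := by
  classical
  induction hd : lexYX.toSyn (lexYX.degree p) using WellFoundedLT.induction generalizing p with
  | _ d ih =>
  by_cases hp0 : p = 0
  · exact ⟨0, fun _ _ => zero_mem _, by simp [hp0]⟩
  set u := lexYX.degree p with hu
  have hup := lexYX.degree_mem_support hp0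
  obtain ⟨k₀, hk₀, hle₀⟩ := exists_expo_le_degree_of_mem hE hp hp0
  rw [← hu, le_iff_fin_two, expo_zero, expo_one] at hle₀
  have hex : ∃ k, E.n k ≤ u 0 := ⟨k₀, hle₀.1⟩
  -- The least such `k` gives `n k ≤ u 0 < n (k - 1)`, which is what bounds the `y`-degree of the
  -- quotient monomial by `e k`. Since `k ≤ k₀`, the `x`-exponent `m k` still fits below `u`.
  obtain ⟨k, hk, hmin⟩ : ∃ k, E.n k ≤ u 0 ∧ ∀ l < k, u 0 < E.n l :=
    ⟨Nat.find hex, Nat.find_spec hex, fun l hl => not_le.1 (Nat.find_min hex hl)⟩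
  have hkk₀ : k ≤ k₀ := by
    by_contra! hlt
    exact absurd (hmin k₀ hlt) (not_lt.2 hle₀.1)
  have hui : u 0 < E.n i := hpn hup
  have hik : i < k := by
    by_contra! hki
    have := n_anti (E := E) hki hi
    omega
  have hkmem : k ∈ Finset.Ioc i E.s := Finset.mem_Ioc.2 ⟨hik, hkk₀.trans hk₀⟩
  have hle : E.expo k ≤ u := by
    rw [le_iff_fin_two, expo_zero, expo_one]
    exact ⟨hk, (m_mono hkk₀ hk₀).trans hle₀.2⟩
  have hek : u 0 - E.n k < E.e k := by
    obtain ⟨l, rfl⟩ : ∃ l, k = l + 1 := ⟨k - 1, by omega⟩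
    have h1 := hmin l (Nat.lt_succ_self _)
    have h2 := n_add_e (E := E) (i := l) (by omega)
    omega
  obtain ⟨hhI, hhk⟩ := hh k hkmem
  obtain ⟨hh1, hh2⟩ := lex_le_expo_of_sub_mem_yLow hhk
  set c := lexYX.leadingCoeff p with hc
  set T : MvPolynomial (Fin 2) K := monomial (u - E.expo k) c with hT
  have hTlow : T ∈ yLow K (E.e k) := monomial_mem_yLow (by
    rw [Finsupp.tsub_apply, expo_zero]; exact hek) _
  have hucoeff : coeff u (T * h k) = c := by
    conv_lhs => rw [← tsub_add_cancel_of_le hle]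
    rw [hT, coeff_monomial_mul, hh1, mul_one]
  have hTsupp : ∀ v ∈ (T * h k).support, v ≠ u → v 0 < u 0 := by
    intro v hv hvu
    obtain ⟨a, ha, b, hb, rfl⟩ := Finset.mem_add.1 (support_mul _ _ hv)
    obtain rfl := Finset.mem_singleton.1 (support_monomial_subset ha)
    have hbk : b ≠ E.expo k := by
      rintro rfl
      exact hvu (tsub_add_cancel_of_le hle)
    have := hh2 b hb hbk
    rw [Finsupp.add_apply, Finsupp.tsub_apply, expo_zero]
    omega
  -- Subtracting `T * h k` cancels the leading term, and every other term of `T * h k` already has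
  -- smaller `y`-degree.
  have hq : ∀ v ∈ (p - T * h k).support, lexYX.toSyn v < lexYX.toSyn u := by
    intro v hv
    have hvu : v ≠ u := by
      rintro rfl
      rw [mem_support_iff, coeff_sub, hucoeff] at hv
      exact hv (sub_self _)
    rcases Finset.mem_union.1 (MvPolynomial.support_sub _ _ _ hv) with hv | hv
    · exact lt_of_le_of_ne (lexYX.le_degree hv) fun h => hvu (lexYX.toSyn.injective h)
    · exact lex_lt_of_zero (hTsupp v hv hvu)
  have hqI : p - T * h k ∈ I := I.sub_mem hp (I.mul_mem_left _ hhI)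
  have hqn : p - T * h k ∈ yLow K (E.n i) := fun v hv =>
    (zero_le_of_lex_le (hq v hv).le).trans_lt hui
  obtain ⟨τ, hτ, hsum⟩ : ∃ τ : ℕ → MvPolynomial (Fin 2) K,
      (∀ j ∈ Finset.Ioc i E.s, τ j ∈ yLow K (E.e j)) ∧
        p - T * h k = ∑ j ∈ Finset.Ioc i E.s, τ j * h j := by
    by_cases hq0 : p - T * h k = 0
    · exact ⟨0, fun _ _ => zero_mem _, by simp [hq0]⟩
    · exact ih _ (hd ▸ hq _ (lexYX.degree_mem_support hq0)) hqI hqn rfl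
  refine ⟨τ + Pi.single k T, fun j hj => add_mem (hτ j hj) ?_, ?_⟩
  · by_cases hjk : j = k
    · subst hjk; rw [Pi.single_eq_same]; exact hTlow
    · rw [Pi.single_eq_of_ne hjk]; exact zero_mem _
  · rw [eq_add_of_sub_eq hsum]
    simp only [Pi.add_apply, add_mul, Finset.sum_add_distrib]
    congr 1
    rw [Finset.sum_eq_single k]
    · rw [Pi.single_eq_same]
    · intro j _ hjk; rw [Pi.single_eq_of_ne hjk, zero_mul]
    · intro h; exact absurd hkmem h

/-- Division by a power of `x` only sorts and shifts monomials in the `x`-direction, so quotient and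
remainder both keep the bound on the `y`-degree. -/
theorem exists_divMonomial {n : ℕ} (d : ℕ) {p : MvPolynomial (Fin 2) R} (hp : p ∈ yLow R n) :
    ∃ q ∈ yLow R n, ∃ r, (∀ u ∈ r.support, u 1 < d ∧ u 0 < n) ∧ p = varX R ^ d * q + r := by
  classical
  refine ⟨divMonomial p (Finsupp.single 1 d), mem_yLow.2 fun u hu => ?_,
    modMonomial p (Finsupp.single 1 d),
    fun u hu => ?_, ?_⟩
  · have h1 := mem_support_iff.1 hu
    rw [coeff_divMonomial] at h1
    simpa using hp (mem_support_iff.2 h1)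
  · have h1 := mem_support_iff.1 hu
    by_cases hle : Finsupp.single 1 d ≤ u
    · rw [coeff_modMonomial_of_le _ hle] at h1
      exact absurd rfl h1
    · rw [coeff_modMonomial_of_not_le _ hle] at h1
      refine ⟨?_, hp (mem_support_iff.2 h1)⟩
      by_contra! h2
      exact hle (Finsupp.single_le_iff.2 h2)
  · rw [varX_pow_eq, divMonomial_add_modMonomial]

/-- The step from `h (i + 1), …, h s` to `h i`. -/
theorem exists_syzygy (hE : initialIdeal I = E.monomialIdeal K) {M : ℕ} (hM : varX K ^ M ∈ I)
    {i : ℕ} (hi : i < E.s) {h : ℕ → MvPolynomial (Fin 2) K}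
    (hh : ∀ j ∈ Finset.Ioc i E.s, h j ∈ I ∧ h j - monomial (E.expo j) 1 ∈ yLow K (E.n j)) :
    ∃ g : MvPolynomial (Fin 2) K, ∃ σ : ℕ → MvPolynomial (Fin 2) K,
      g ∈ I ∧ g - monomial (E.expo i) 1 ∈ yLow K (E.n i) ∧
      (∀ j ∈ Finset.Ioc i E.s, ∀ u ∈ (σ j).support, u 1 < E.d (i + 1) ∧ u 0 < E.e j) ∧
      varX K ^ E.d (i + 1) * g =
        varY K ^ E.e (i + 1) * h (i + 1) + ∑ j ∈ Finset.Ioc i E.s, σ j * h j := by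
  obtain ⟨G, hG, hGlow⟩ := exists_mem_sub_mem_yLow hE hM hi.le
  obtain ⟨hI1, hlow1⟩ := hh (i + 1) (Finset.mem_Ioc.2 ⟨by omega, by omega⟩)
  have hexp : varX K ^ E.d (i + 1) * monomial (E.expo i) 1 =
      varY K ^ E.e (i + 1) * monomial (E.expo (i + 1)) 1 := by
    have hadd : Finsupp.single 1 (E.d (i + 1)) + E.expo i =
        Finsupp.single 0 (E.e (i + 1)) + E.expo (i + 1) := by
      rw [expo, expo, ← m_add_d hi, ← n_add_e hi, Finsupp.single_add, Finsupp.single_add]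
      abel
    rw [varX_pow_eq, varY_pow_eq, monomial_mul, monomial_mul, hadd]
  -- The terms `x ^ m (i + 1) * y ^ n i` cancel, and what remains can be expressed through the later
  -- basis elements.
  have hplow : varX K ^ E.d (i + 1) * G - varY K ^ E.e (i + 1) * h (i + 1) ∈ yLow K (E.n i) := by
    have h1 : varX K ^ E.d (i + 1) * G - varY K ^ E.e (i + 1) * h (i + 1) =
        varX K ^ E.d (i + 1) * (G - monomial (E.expo i) 1) -
          varY K ^ E.e (i + 1) * (h (i + 1) - monomial (E.expo (i + 1)) 1) := by
      linear_combination hexp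
    rw [h1]
    refine sub_mem ?_ ?_
    · rw [← zero_add (E.n i)]
      refine mul_mem_yLow ?_ hGlow
      rw [varX_pow_eq]; exact monomial_mem_yLow (by simp) _
    · rw [← n_add_e hi, add_comm]
      refine mul_mem_yLow ?_ hlow1
      rw [varY_pow_eq]; exact monomial_mem_yLow (by simp) _
  obtain ⟨τ, hτ, hsum⟩ := exists_combination hE hi.le hh
    (I.sub_mem (I.mul_mem_left _ hG) (I.mul_mem_left _ hI1)) hplow
  have hdiv : ∀ j, ∃ q σ : MvPolynomial (Fin 2) K, j ∈ Finset.Ioc i E.s →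
      q ∈ yLow K (E.e j) ∧ (∀ u ∈ σ.support, u 1 < E.d (i + 1) ∧ u 0 < E.e j) ∧
        τ j = varX K ^ E.d (i + 1) * q + σ := by
    intro j
    by_cases hj : j ∈ Finset.Ioc i E.s
    · obtain ⟨q, hq, r, hr, heq⟩ := exists_divMonomial (E.d (i + 1)) (hτ j hj)
      exact ⟨q, r, fun _ => ⟨hq, hr, heq⟩⟩
    · exact ⟨0, 0, fun h => absurd h hj⟩
  choose q σ hqσ using hdiv
  -- The multiples of `x ^ d (i + 1)` in the coefficients are absorbed into `G`, leaving
  -- coefficients of small `x`-degree. The correction has `y`-degree less than `e j + n j = n (j -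
  -- 1) ≤ n i`, so the top term survives.
  refine ⟨G - ∑ j ∈ Finset.Ioc i E.s, q j * h j, σ,
    I.sub_mem hG (sum_mem fun j hj => I.mul_mem_left _ (hh j hj).1), ?_,
    fun j hj => (hqσ j hj).2.1, ?_⟩
  · rw [sub_right_comm]
    refine sub_mem hGlow (sum_mem fun j hj => ?_)
    obtain ⟨hij, hjs⟩ := Finset.mem_Ioc.1 hj
    obtain ⟨l, rfl⟩ : ∃ l, j = l + 1 := ⟨j - 1, by omega⟩
    have h1 := mul_mem_yLow (mem_yLow_succ_of_sub_mem_yLow (hh _ hj).2) (hqσ _ hj).1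
    rw [n_add_e (by omega), mul_comm] at h1
    exact yLow_mono (n_anti (by omega) (by omega)) h1
  · have h2 : ∑ j ∈ Finset.Ioc i E.s, τ j * h j =
        varX K ^ E.d (i + 1) * ∑ j ∈ Finset.Ioc i E.s, q j * h j +
          ∑ j ∈ Finset.Ioc i E.s, σ j * h j := by
      rw [Finset.mul_sum, ← Finset.sum_add_distrib]
      refine Finset.sum_congr rfl fun j hj => ?_
      rw [(hqσ j hj).2.2]
      ring
    linear_combination hsum + h2

theorem exists_syzygies (hE : initialIdeal I = E.monomialIdeal K) {M : ℕ} (hM : varX K ^ M ∈ I)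
    {i : ℕ} (hi : i ≤ E.s) :
    ∃ g : ℕ → MvPolynomial (Fin 2) K, ∃ σ : ℕ → ℕ → MvPolynomial (Fin 2) K,
      (∀ j, i ≤ j → j ≤ E.s → g j ∈ I ∧ g j - monomial (E.expo j) 1 ∈ yLow K (E.n j)) ∧
      g E.s = varX K ^ E.m E.s ∧
      ∀ k, i ≤ k → k < E.s →
        (∀ j ∈ Finset.Ioc k E.s, ∀ u ∈ (σ j k).support, u 1 < E.d (k + 1) ∧ u 0 < E.e j) ∧
        varX K ^ E.d (k + 1) * g k =
          varY K ^ E.e (k + 1) * g (k + 1) + ∑ j ∈ Finset.Ioc k E.s, σ j k * g j := by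
  induction hi using Nat.decreasingInduction with
  | self =>
    obtain ⟨G, hG, hlow⟩ := exists_mem_sub_mem_yLow hE hM (le_refl E.s)
    have hexp : monomial (E.expo E.s) (1 : K) = varX K ^ E.m E.s := by
      rw [varX_pow_eq, expo, E.n_last, Finsupp.single_zero, zero_add]
    refine ⟨fun _ => varX K ^ E.m E.s, 0, fun j h1 h2 => ?_, rfl, fun k h1 h2 => by omega⟩
    obtain rfl : j = E.s := le_antisymm h2 h1
    rw [hexp, sub_self]
    refine ⟨?_, zero_mem _⟩
    rw [E.n_last, hexp] at hlow
    -- As `n s = 0`, a polynomial of `y`-degree less than `n s` is zero, so `x ^ m s` itself lies in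
    -- `I`.
    have h3 : G - varX K ^ E.m E.s = 0 :=
      support_eq_empty.1 (Finset.eq_empty_of_forall_notMem fun u hu => absurd (hlow hu) (by simp))
    rwa [← sub_eq_zero.1 h3]
  | of_succ i hi ih =>
    obtain ⟨g, σ, hg, hgs, hσ⟩ := ih
    obtain ⟨gi, σi, h1, h2, h3, h4⟩ := exists_syzygy hE hM hi (h := g) fun j hj => by
      have := Finset.mem_Ioc.1 hj
      exact hg j (by omega) this.2
    -- The sums for `k ≥ i` only involve indices `j > k`, so they never see the newly inserted value
    -- at `i`.
    have hne : ∀ j, i < j → Function.update g i gi j = g j := fun j hj =>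
      Function.update_of_ne (by omega) _ _
    refine ⟨Function.update g i gi, fun j k => if k = i then σi j else σ j k,
      fun j hij hjs => ?_, ?_, fun k hik hks => ?_⟩
    · rcases hij.eq_or_lt with rfl | hij
      · rw [Function.update_self]; exact ⟨h1, h2⟩
      · rw [hne j hij]; exact hg j hij hjs
    · rw [hne _ hi, hgs]
    · have hsum : ∀ τ : ℕ → MvPolynomial (Fin 2) K,
          ∑ j ∈ Finset.Ioc k E.s, τ j * Function.update g i gi j =
            ∑ j ∈ Finset.Ioc k E.s, τ j * g j := fun τ =>
        Finset.sum_congr rfl fun j hj => by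
          rw [hne j (by have := Finset.mem_Ioc.1 hj; omega)]
      rw [hsum, hne (k + 1) (by omega)]
      rcases hik.eq_or_lt with rfl | hik
      · simp only [if_true, Function.update_self]
        exact ⟨h3, h4⟩
      · simp only [if_neg (show k ≠ i by omega)]
        rw [hne k hik]
        exact hσ k hik hks

/-- Existence of Gröbner parameters for an ideal that contains a power of `x`. -/
theorem exists_params (hE : initialIdeal I = E.monomialIdeal K) {M : ℕ} (hM : varX K ^ M ∈ I) :
    ∃ c : E.Param → K, DiagZero c ∧ E.idealOf c = I := by
  classical
  obtain ⟨g, σ, hg, hgs, hσ⟩ := exists_syzygies hE hM (Nat.zero_le E.s)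
  let c : E.Param → K := fun p =>
    if p.j = p.i then 0 else coeff (Finsupp.single 0 p.b + Finsupp.single 1 p.a) (σ p.j p.i)
  have hc : DiagZero c := fun p hp => if_pos hp
  have hσc : ∀ k < E.s, ∀ j ∈ Finset.Ioc k E.s, E.sigma c j k = σ j k := by
    intro k hk j hj
    obtain ⟨hkj, hjs⟩ := Finset.mem_Ioc.1 hj
    ext u
    by_cases hu : u 1 < E.d (k + 1) ∧ u 0 < E.e j
    · have h1 := coeff_sigma c ⟨k, j, u 1, u 0, hk, hkj.le, hjs, hu.1, by
        rw [if_neg (by omega)]; exact hu.2⟩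
      rw [← eq_single_add_single] at h1
      rw [h1]
      change (if j = k then 0 else coeff _ (σ j k)) = _
      rw [if_neg (by omega), ← eq_single_add_single]
    · rw [notMem_support_iff.1 fun h => hu ((hσ k (Nat.zero_le _) hk).1 j hj u h),
        notMem_support_iff.1 fun h => hu ?_]
      have := support_sigma c h
      rwa [if_neg (by omega)] at this
  have hgh : ∀ i ≤ E.s, g i = E.h c i := fun i hi => by
    refine eq_h_of_syzygy c g (by rw [hgs, hc.prod_D le_rfl]) (fun k hk => ?_) hi
    rw [(hσ k (Nat.zero_le _) hk).2, add_sub_cancel_left, ← Finset.Ioc_insert_left hk.le,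
      Finset.sum_insert (by simp), hc.sigma_self, zero_mul, zero_add]
    exact Finset.sum_congr rfl fun j hj => by rw [hσc k hk j hj]
  have hle : E.idealOf c ≤ I := by
    rw [idealOf, Ideal.span_le]
    rintro _ ⟨i, hi, rfl⟩
    rw [← hgh i hi]
    exact (hg i (Nat.zero_le _) hi).1
  -- For the reverse inclusion, the remainder of an element of `I` stays in `I` but has no exponent
  -- in the initial ideal of `I`, hence vanishes.
  refine ⟨c, hc, le_antisymm hle fun p hp => ?_⟩
  obtain ⟨r, hr, hseg⟩ := exists_isRemainder c p
  by_cases hr0 : r = 0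
  · rwa [hr0, sub_zero] at hr
  · have hrI : r ∈ I := by
      have := I.sub_mem hp (hle hr)
      rwa [sub_sub_cancel] at this
    obtain ⟨k, hk, hkle⟩ := exists_expo_le_degree_of_mem hE hrI hr0
    exact absurd hkle (hseg (lexYX.degree_mem_support hr0) k hk)

end Staircase

/-! ### Punctual parameters and the substitution `x = 0` -/

namespace Staircase

variable {E : Staircase} {R : Type*} [CommRing R]

variable (R) in
/-- The substitution `x = 0`. -/
noncomputable def setXZero : MvPolynomial (Fin 2) R →ₐ[R] MvPolynomial (Fin 2) R :=
  aeval ![varY R, 0]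

theorem setXZero_varX : setXZero R (varX R) = 0 := by simp [setXZero]

theorem setXZero_varY : setXZero R (varY R) = varY R := by simp [setXZero]

theorem sub_setXZero_mem (p : MvPolynomial (Fin 2) R) :
    p - setXZero R p ∈ Ideal.span {varX R} := by
  induction p using MvPolynomial.induction_on with
  | C a =>
    rw [← algebraMap_eq, AlgHom.commutes, sub_self]
    exact zero_mem _
  | add p q hp hq =>
    rw [map_add, add_sub_add_comm]
    exact add_mem hp hq
  | mul_X p i hp =>
    have hi : X i - setXZero R (X i) ∈ Ideal.span {varX R} := by
      fin_cases i
      · change varY R - setXZero R (varY R) ∈ _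
        rw [setXZero_varY, sub_self]
        exact zero_mem _
      · change varX R - setXZero R (varX R) ∈ _
        rw [setXZero_varX, sub_zero]
        exact Ideal.subset_span rfl
    have h : p * X i - setXZero R (p * X i) =
        X i * (p - setXZero R p) + setXZero R p * (X i - setXZero R (X i)) := by
      rw [map_mul]
      ring
    rw [h]
    exact add_mem (Ideal.mul_mem_left _ _ hp) (Ideal.mul_mem_left _ _ hi)

open Classical in
theorem setXZero_sigma (c : E.Param → R) (j i : ℕ) :
    setXZero R (E.sigma c j i) = E.sigma (fun p => if p.a = 0 then c p else 0) j i := by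
  rw [sigma, sigma, map_sum]
  refine Finset.sum_congr rfl fun p _ => ?_
  split_ifs with h1 h2
  · rw [map_mul, map_mul, map_pow, map_pow, setXZero_varX, setXZero_varY, h2, pow_zero, pow_zero,
      ← algebraMap_eq, AlgHom.commutes]
  · rw [map_mul, map_mul, map_pow, setXZero_varX, zero_pow h2, mul_zero, zero_mul, C_0, zero_mul,
      zero_mul]
  · exact map_zero _

-- With zero diagonal, every term of the recursion with `j ≥ i + 2` carries the factor `D (i + 2)`,
-- a positive power of `x`. At `x = 0` only `j = i + 1` survives and the recursion becomes a
-- product.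
open Classical in
theorem DiagZero.setXZero_cofactor {c : E.Param → R} (hc : DiagZero c) {i : ℕ} (hi : i ≤ E.s) :
    setXZero R (E.cofactor c i) = ∏ k ∈ Finset.Ico i E.s,
      (varY R ^ E.e (k + 1) + E.sigma (fun p => if p.a = 0 then c p else 0) (k + 1) k) := by
  induction hi using Nat.decreasingInduction with
  | self => rw [cofactor_last, map_one, Finset.Ico_self, Finset.prod_empty]
  | of_succ i hi ih =>
    rw [cofactor_step c hi, Finset.prod_eq_prod_Ico_succ_bot hi, ← ih, map_add, map_sum,
      Finset.sum_eq_single (i + 1)]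
    · rw [Finset.Icc_eq_empty (by omega), Finset.prod_empty, mul_one, map_mul, map_mul, map_pow,
        setXZero_varY, setXZero_sigma, add_mul]
    · intro j hj hne
      have := Finset.mem_Ioc.1 hj
      rw [map_mul, map_mul, map_prod, Finset.prod_eq_zero (i := i + 2), mul_zero, zero_mul]
      · exact Finset.mem_Icc.2 ⟨le_rfl, by omega⟩
      · rw [hc.D_eq, map_pow, setXZero_varX, zero_pow (d_pos (by omega)).ne']
    · intro h; exact absurd (Finset.mem_Ioc.2 ⟨by omega, by omega⟩) h

theorem DiagZero.h_zero {c : E.Param → R} (hc : DiagZero c) : E.h c 0 = E.cofactor c 0 := by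
  rw [hc.h_eq (Nat.zero_le _), E.m_zero, pow_zero, one_mul]

theorem diagZero_of_not_punctual {c : E.Param → R}
    (hc : ∀ p : E.Param, ¬ E.IsPunctual p → c p = 0) :
    DiagZero c := fun p hp => hc p fun h => h.1 hp

/-- For punctual parameters, `⟨x, y⟩` is contained in the radical of `⟨h 0, …, h s⟩`. -/
theorem span_le_radical {c : E.Param → R} (hc : ∀ p : E.Param, ¬ E.IsPunctual p → c p = 0) :
    Ideal.span {varX R, varY R} ≤ (E.idealOf c).radical := by
  classical
  have hd := diagZero_of_not_punctual hc
  have hx : varX R ∈ (E.idealOf c).radical := by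
    refine ⟨E.m E.s, ?_⟩
    rw [← hd.h_last]
    exact h_mem c le_rfl
  refine Ideal.span_le.2 (Set.pair_subset hx ?_)
  -- Punctuality says precisely that each `σ_{k + 1, k}` vanishes at `x = 0`, so `h 0` becomes a
  -- pure power of `y`.
  have h1 : setXZero R (E.h c 0) = varY R ^ ∑ k ∈ Finset.Ico 0 E.s, E.e (k + 1) := by
    rw [hd.h_zero, hd.setXZero_cofactor (Nat.zero_le _), ← Finset.prod_pow_eq_pow_sum]
    refine Finset.prod_congr rfl fun k _ => ?_
    rw [sigma_eq_zero_of, add_zero]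
    intro p hpi hpj
    split_ifs with ha
    · exact hc p fun h => h.2 (by omega) ha
    · rfl
  have h2 := sub_setXZero_mem (E.h c 0)
  have h3 : Ideal.span {varX R} ≤ (E.idealOf c).radical :=
    (Ideal.span_singleton_le_iff_mem _).2 hx
  have h4 := sub_mem (Ideal.le_radical (h_mem c (Nat.zero_le E.s))) (h3 h2)
  rw [sub_sub_cancel, h1] at h4
  obtain ⟨N, hN⟩ := h4
  exact ⟨_, by rwa [← pow_mul] at hN⟩

variable {K : Type*} [Field K]

/-- A variable is prime, so the divisors of its powers are unit multiples of powers; monicity fixes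
the unit. -/
theorem eq_monomial_of_dvd_X_pow {p : MvPolynomial (Fin 2) K} (hp : lexYX.Monic p) {i : Fin 2}
    {M : ℕ} (hdvd : p ∣ X i ^ M) : p = monomial (lexYX.degree p) 1 := by
  classical
  obtain ⟨k, -, hk⟩ := (dvd_prime_pow (X_prime (i := i)) M).1 hdvd
  obtain ⟨u, hu⟩ := hk.symm
  obtain ⟨r, hr, hru⟩ := isUnit_iff_eq_C_of_isReduced.1 u.isUnit
  rw [hru, X_pow_eq_monomial, mul_comm, C_mul_monomial, mul_one] at hu
  have h1 := hp.leadingCoeff_eq_one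
  rw [← hu, MonomialOrder.leadingCoeff_monomial] at h1
  rw [← hu, h1, lexYX.degree_monomial, if_neg one_ne_zero]

/-- If `⟨h 0, …, h s⟩` contains `x ^ m s`, then all `σ_{i, i}` vanish. -/
theorem diagZero_of_mem {c : E.Param → K} (hx : varX K ^ E.m E.s ∈ E.idealOf c) :
    DiagZero c := by
  classical
  obtain ⟨hmon, hdeg⟩ := monic_h c (le_refl E.s)
  have hexp : E.expo E.s = Finsupp.single 1 (E.m E.s) := by
    rw [expo, E.n_last, Finsupp.single_zero, zero_add]
  rw [hexp] at hdeg
  -- Both elements of the ideal have leading monomial `x ^ m s`, so the difference only involves `x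
  -- ^ a` with `a < m s`. These monomials lie outside the staircase ideal.
  have hs : E.h c E.s = varX K ^ E.m E.s := by
    refine sub_eq_zero.1 (eq_zero_of_mem_idealOf c (sub_mem (h_mem c le_rfl) hx) ?_)
    intro v hv i hi hle
    have hv0 : v ≠ Finsupp.single 1 (E.m E.s) := by
      rintro rfl
      have h1 := hmon.coeff_degree
      rw [hdeg] at h1
      rw [Finset.mem_coe, mem_support_iff, coeff_sub, h1, varX_pow_eq, coeff_monomial, if_pos rfl,
        sub_self] at hv
      exact hv rfl
    have hvh : v ∈ (E.h c E.s).support := by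
      rw [Finset.mem_coe, mem_support_iff, coeff_sub, varX_pow_eq, coeff_monomial,
        if_neg hv0.symm, sub_zero] at hv
      exact mem_support_iff.2 hv
    have hlex := lexYX.le_degree hvh
    rw [hdeg] at hlex
    have h0 : v 0 = 0 := by simpa using zero_le_of_lex_le hlex
    have h1 : v 1 < E.m E.s := by
      by_contra! hge
      refine absurd hlex (not_le.2 ?_)
      refine lt_of_le_of_ne ?_ fun h => hv0 (lexYX.toSyn.injective h).symm
      exact lexYX.toSyn_monotone (le_iff_fin_two.2 ⟨by simp, by simpa using hge⟩)
    rw [le_iff_fin_two, expo_zero, expo_one] at hle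
    rcases hi.eq_or_lt with rfl | hi
    · omega
    · have := E.n_lt i hi
      omega
  intro p hp
  have hdvd : E.D c (p.i + 1) ∣ varX K ^ E.m E.s := by
    rw [← hs, h_last]
    exact Finset.dvd_prod_of_mem _ (Finset.mem_Icc.2 ⟨by omega, p.hi⟩)
  have h1 := eq_monomial_of_dvd_X_pow (monic_D c p.i).1 hdvd
  rw [(monic_D c p.i).2, D, varX_pow_eq, Nat.add_sub_cancel, sub_eq_self] at h1
  rw [← coeff_sigma c p, hp, h1, coeff_zero]

/-- If `⟨h 0, …, h s⟩` contains a power of `y` and all `σ_{i, i}` vanish, then the parameters are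
punctual. -/
theorem DiagZero.eq_zero_of_not_punctual {c : E.Param → K} (hc : DiagZero c) {M : ℕ}
    (hy : varY K ^ M ∈ E.idealOf c) (p : E.Param) (hp : ¬ E.IsPunctual p) : c p = 0 := by
  classical
  by_cases hpd : p.j = p.i
  · exact hc p hpd
  obtain ⟨hpj, hpa⟩ : p.j = p.i + 1 ∧ p.a = 0 := by
    by_contra h
    exact hp ⟨hpd, fun h1 h2 => h ⟨h1, h2⟩⟩
  -- For `i > 0` the polynomial `h i` is divisible by `x`, so at `x = 0` the ideal is generated by
  -- the image of `h 0` alone. Each factor of that image then divides a power of `y`.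
  have h1 : (E.idealOf c).map (setXZero K) ≤ Ideal.span {setXZero K (E.h c 0)} := by
    rw [idealOf, Ideal.map_span, Ideal.span_le]
    rintro _ ⟨_, ⟨i, hi, rfl⟩, rfl⟩
    rcases Nat.eq_zero_or_pos i with rfl | hi0
    · exact Ideal.subset_span rfl
    · have h2 : setXZero K (E.h c i) = 0 := by
        have h3 := E.m_lt 0 (by omega)
        have h4 := m_mono (E := E) (i := 0 + 1) hi0 hi
        rw [hc.h_eq hi, map_mul, map_pow, setXZero_varX, zero_pow (by omega), zero_mul]
      change setXZero K (E.h c i) ∈ _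
      rw [h2]
      exact zero_mem _
  have h2 := h1 (Ideal.mem_map_of_mem (setXZero K) hy)
  rw [map_pow, setXZero_varY, Ideal.mem_span_singleton, hc.h_zero,
    hc.setXZero_cofactor (Nat.zero_le _)] at h2
  set c₀ : E.Param → K := fun p => if p.a = 0 then c p else 0 with hc₀
  have hdeg : lexYX.degree (varY K ^ E.e (p.i + 1)) = Finsupp.single 0 (E.e (p.i + 1)) := by
    rw [varY_pow_eq, lexYX.degree_monomial, if_neg one_ne_zero]
  have h3 := monic_add_of_support (f := varY K ^ E.e (p.i + 1)) (g := E.sigma c₀ (p.i + 1) p.i)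
    MonomialOrder.monic_X.pow fun u hu => by
      rw [hdeg]
      have := (support_sigma c₀ hu).2
      rw [if_neg (by omega)] at this
      exact lex_lt_of_zero (by simpa using this)
  have h4 := eq_monomial_of_dvd_X_pow h3.1
    ((Finset.dvd_prod_of_mem (fun k => varY K ^ E.e (k + 1) + E.sigma c₀ (k + 1) k)
      (Finset.mem_Ico.2 ⟨Nat.zero_le _, p.hi⟩)).trans h2)
  rw [h3.2, hdeg, varY_pow_eq, add_eq_left] at h4
  have h5 := coeff_sigma c₀ p
  rw [hpj, h4, coeff_zero] at h5
  rw [h5, hc₀]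
  exact (if_pos hpa).symm

end Staircase

/-! ### The maximal ideal of a rational point -/

section PointIdeal

variable {K ι : Type*} [Field K]

theorem X_sub_C_mem_pointIdeal (a : ι → K) (i : ι) : X i - C (a i) ∈ pointIdeal a := by
  rw [pointIdeal, RingHom.mem_ker, map_sub, eval_X, eval_C, sub_self]

theorem pointIdeal_eq_span (a : ι → K) :
    pointIdeal a = Ideal.span (Set.range fun i => X i - C (a i)) := by
  have key : ∀ p, p - C (eval a p) ∈ Ideal.span (Set.range fun i => X i - C (a i)) := by
    intro p
    induction p using MvPolynomial.induction_on with
    | C r =>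
      rw [eval_C, sub_self]
      exact zero_mem _
    | add p q hp hq =>
      rw [map_add, map_add, add_sub_add_comm]
      exact add_mem hp hq
    | mul_X p i hp =>
      have h : p * X i - C (eval a (p * X i)) =
          X i * (p - C (eval a p)) + C (eval a p) * (X i - C (a i)) := by
        rw [map_mul, eval_X, map_mul]
        ring
      rw [h]
      exact add_mem (Ideal.mul_mem_left _ _ hp)
        (Ideal.mul_mem_left _ _ (Ideal.subset_span (Set.mem_range_self i)))
  refine le_antisymm (fun p hp => ?_) (Ideal.span_le.2 ?_)
  · have h1 : eval a p = 0 := hp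
    have h2 := key p
    rwa [h1, C_0, sub_zero] at h2
  · rintro _ ⟨i, rfl⟩
    exact X_sub_C_mem_pointIdeal a i

theorem isMaximal_pointIdeal (a : ι → K) : (pointIdeal a).IsMaximal :=
  RingHom.ker_isMaximal_of_surjective _ fun r => ⟨C r, eval_C r⟩

/-- The quotient is the residue field of the local ring, and a fraction `p / q` there equals the
constant `p(a) / q(a)`. -/
theorem solutionMultiplicity_pointIdeal (a : ι → K) :
    solutionMultiplicity (pointIdeal a) a = 1 := by
  have hmap : (pointIdeal a).map
      (algebraMap (MvPolynomial ι K) (Localization.AtPrime (pointIdeal a))) =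
        IsLocalRing.maximalIdeal (Localization.AtPrime (pointIdeal a)) :=
    Localization.AtPrime.map_eq_maximalIdeal
  have hne : (pointIdeal a).map
      (algebraMap (MvPolynomial ι K) (Localization.AtPrime (pointIdeal a))) ≠ ⊤ := by
    rw [hmap]; exact Ideal.IsPrime.ne_top'
  have := Ideal.Quotient.nontrivial_iff.2 hne
  refine finrank_eq_one (Ideal.Quotient.mk _ 1) (by rw [map_one]; exact one_ne_zero) fun w => ?_
  obtain ⟨w, rfl⟩ := Ideal.Quotient.mk_surjective w
  obtain ⟨⟨p, q⟩, hpq⟩ := IsLocalization.surj (pointIdeal a).primeCompl w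
  have hq : eval a q.1 ≠ 0 := q.2
  have h1 : C (eval a p / eval a q.1) * q.1 - p ∈ pointIdeal a := by
    change eval a _ = 0
    rw [map_sub, map_mul, eval_C, div_mul_cancel₀ _ hq, sub_self]
  have h2 := Ideal.mem_map_of_mem
    (algebraMap (MvPolynomial ι K) (Localization.AtPrime (pointIdeal a))) h1
  rw [map_sub, map_mul, ← hpq, ← sub_mul] at h2
  have h3 := (Ideal.mul_unit_mem_iff_mem _
    (IsLocalization.map_units (Localization.AtPrime (pointIdeal a)) q)).1 h2
  have h4 : (eval a p / eval a q.1) • (1 : Localization.AtPrime (pointIdeal a)) =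
      algebraMap (MvPolynomial ι K) _ (C (eval a p / eval a q.1)) := by
    rw [Algebra.smul_def, mul_one, ← algebraMap_eq, ← IsScalarTower.algebraMap_apply]
  rw [← h4] at h3
  exact ⟨eval a p / eval a q.1, Ideal.Quotient.eq.2 h3⟩

/-- If polynomials generate the ideal of a point, then their Jacobian matrix at this point has
trivial kernel. -/
theorem eq_zero_of_span_eq_pointIdeal {κ : Type*} [Fintype ι] {a : ι → K}
    {F : κ → MvPolynomial ι K} (hF : Ideal.span (Set.range F) = pointIdeal a) {v : ι → K}
    (hv : ∀ k, ∑ i, eval a (pderiv i (F k)) * v i = 0) : v = 0 := by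
  classical
  -- The derivative at `a` in direction `v` passes from generators to the whole ideal by the product
  -- rule, since elements of the ideal vanish at `a`. Applied to `X j - a j` it yields `v j`.
  have key : ∀ q ∈ Ideal.span (Set.range F), ∑ i, eval a (pderiv i q) * v i = 0 := by
    intro q hq
    induction hq using Submodule.span_induction with
    | mem x hx => obtain ⟨k, rfl⟩ := hx; exact hv k
    | zero => simp
    | add x y _ _ hx hy => simp only [map_add, add_mul, Finset.sum_add_distrib, hx, hy, add_zero]
    | smul b x hx ih =>
      have h0 : eval a x = 0 := by
        have h1 : x ∈ pointIdeal a := hF ▸ hx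
        exact h1
      have h2 : ∀ i, eval a (pderiv i (b • x)) * v i = eval a b * (eval a (pderiv i x) * v i) := by
        intro i
        rw [smul_eq_mul, Derivation.leibniz, map_add, smul_eq_mul, smul_eq_mul, map_mul, map_mul,
          h0]
        ring
      rw [Finset.sum_congr rfl fun i _ => h2 i, ← Finset.mul_sum, ih, mul_zero]
  funext j
  have h1 := key (X j - C (a j)) (hF ▸ X_sub_C_mem_pointIdeal a j)
  rw [Finset.sum_eq_single j] at h1
  · simpa using h1
  · intro i _ hij
    rw [map_sub, pderiv_C, sub_zero, pderiv_X_of_ne hij.symm, map_zero, zero_mul]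
  · intro h; exact absurd (Finset.mem_univ _) h

end PointIdeal

/-- A primary component contained in `P` is contained in the sum of the whole ideal with any power
of the maximal ideal `P`. -/
theorem le_mul_sup_pow {A : Type*} [CommRing A] {I I' P : Ideal A} (hP : I ≤ P)
    (hsup : I ⊔ I' = ⊤) (n : ℕ) : I ≤ I * I' ⊔ P ^ n := by
  have h0 : P ⊔ I' = ⊤ := top_le_iff.1 (hsup.ge.trans (sup_le_sup_right hP I'))
  have h1 : P ^ n ⊔ I' = ⊤ := Ideal.pow_sup_eq_top h0
  have h2 : I * P ^ n ≤ I * I' ⊔ P ^ n := le_trans Ideal.mul_le_right le_sup_right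
  have h3 : I * I' ≤ I * I' ⊔ P ^ n := le_sup_left
  have h4 : I = I * P ^ n ⊔ I * I' := by rw [← Ideal.mul_sup, h1, Ideal.mul_top]
  exact h4.le.trans (sup_le h2 h3)

/-! ### The punctual equations over arbitrary rings -/

namespace Staircase

variable {E : Staircase} {R : Type*} [CommRing R] {K : Type*} [Field K]

theorem rem_eq {c : E.Param → R} {f r : MvPolynomial (Fin 2) R} (hr : E.IsRemainder c f r) :
    E.rem c f = r :=
  (existsUnique_isRemainder c f).unique (isRemainder_rem E c f) hr

/-- Uniqueness of remainders turns ideal membership into polynomial conditions on the parameters. -/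
theorem mem_idealOf_iff {c : E.Param → R} {f : MvPolynomial (Fin 2) R} :
    f ∈ E.idealOf c ↔ ∀ μ : E.seg, coeff μ.1 (E.rem c f) = 0 := by
  have hr := isRemainder_rem E c f
  constructor
  · intro hf μ
    rw [rem_eq (r := 0) ⟨by rwa [sub_zero], by simp⟩, coeff_zero]
  · intro h
    have h0 : E.rem c f = 0 := by
      refine support_eq_empty.1 (Finset.eq_empty_of_forall_notMem fun u hu => ?_)
      exact mem_support_iff.1 hu (h ⟨u, hr.2 hu⟩)
    have := hr.1
    rwa [h0, sub_zero] at this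

open Classical in
/-- The vector of Gröbner parameters with the given punctual entries. -/
noncomputable def extendParam (a : E.PunctualParam → R) : E.Param → R :=
  fun p => if hp : E.IsPunctual p then a ⟨p, hp⟩ else 0

theorem extendParam_of_not {a : E.PunctualParam → R} (p : E.Param) (hp : ¬ E.IsPunctual p) :
    extendParam a p = 0 := dif_neg hp

theorem extendParam_coe (a : E.PunctualParam → R) (p : E.PunctualParam) :
    extendParam a p.1 = a p := dif_pos p.2

open Classical in
variable (E K) in
/-- The substitution that sets the indeterminates that are not punctual parameters to zero. -/
noncomputable def toPunctual : MvPolynomial E.Param K →ₐ[K] MvPolynomial E.PunctualParam K :=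
  aeval (fun p : E.Param => if hp : E.IsPunctual p then X (⟨p, hp⟩ : E.PunctualParam) else 0)

theorem punctualEquation_eq (f : MvPolynomial (Fin 2) K) (μ : E.seg) :
    E.punctualEquation f μ = toPunctual E K (E.equation f μ) := rfl

theorem map_toPunctual_X (φ : MvPolynomial E.PunctualParam K →+* R) (p : E.Param) :
    φ (toPunctual E K (X p)) = extendParam (fun p => φ (X p)) p := by
  rw [toPunctual, aeval_X, extendParam]
  split_ifs
  · rfl
  · exact map_zero φ

theorem toPunctual_C (r : K) : toPunctual E K (C r) = C r := by
  rw [algHom_C, algebraMap_eq]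

/-- A point is a solution of the punctual equations of `f` if and only if `f` lies in the ideal with
these punctual parameters. -/
theorem punctualEquation_eq_zero_iff (φ : MvPolynomial E.PunctualParam K →+* R)
    (f : MvPolynomial (Fin 2) K) :
    (∀ μ : E.seg, φ (E.punctualEquation f μ) = 0) ↔
      map (φ.comp C) f ∈ E.idealOf (extendParam fun p => φ (X p)) := by
  set ψ : MvPolynomial E.Param K →+* R := φ.comp (toPunctual E K : _ →+* _) with hψ
  have hψa : ∀ q, ψ q = φ (toPunctual E K q) := fun q => rfl
  have hX : (fun p : E.Param => ψ (X p)) = extendParam fun p => φ (X p) := by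
    funext p
    rw [hψa, map_toPunctual_X]
  have hC : ψ.comp C = φ.comp C := by
    refine RingHom.ext fun r => ?_
    exact congrArg φ (toPunctual_C r)
  -- Specializing the generic remainder along `ψ` gives the remainder at the specialized parameters,
  -- whose vanishing is membership.
  have h1 := (isRemainder_rem E (X : E.Param → MvPolynomial E.Param K) (map C f)).map ψ
  rw [hX, map_map, hC] at h1
  rw [mem_idealOf_iff, rem_eq h1]
  refine forall_congr' fun μ => ?_
  rw [coeff_map, hψa, punctualEquation_eq, equation]

theorem map_idealOf_le {c : E.Param → K} {κ : K →+* R} {S : Ideal (MvPolynomial (Fin 2) R)}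
    (h : (E.idealOf c).map (map κ) ≤ S) : E.idealOf (fun p => κ (c p)) ≤ S := by
  rw [idealOf, Ideal.span_le]
  rintro _ ⟨i, hi, rfl⟩
  rw [← map_h κ c hi]
  exact h (Ideal.mem_map_of_mem _ (h_mem c hi))

/-- Punctual parameters over any ring for which the ideal contains `J = I * I'` are those of `I`. -/
theorem eq_of_map_le {I I' : Ideal (MvPolynomial (Fin 2) K)}
    (hP : I ≤ Ideal.span {varX K, varY K}) (hsup : I ⊔ I' = ⊤) {lam : E.Param → K}
    (hlam : DiagZero lam) (hI : E.idealOf lam = I) {κ : K →+* R} {c : E.Param → R}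
    (hc : ∀ p, ¬ E.IsPunctual p → c p = 0) (hle : (I * I').map (map κ) ≤ E.idealOf c) :
    c = fun p => κ (lam p) := by
  -- As `⟨x, y⟩` is finitely generated, one exponent `n`, depending on `c`, puts its whole power
  -- inside the ideal.
  obtain ⟨n, hn⟩ := Ideal.exists_pow_le_of_le_radical_of_fg (span_le_radical hc)
    (Submodule.fg_span (Set.toFinite _))
  refine (eq_of_idealOf_le (fun p hp => ?_) (diagZero_of_not_punctual hc) (map_idealOf_le ?_)).symm
  · rw [hlam p hp, map_zero]
  · rw [hI]
    refine (Ideal.map_mono (le_mul_sup_pow hP hsup n)).trans ?_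
    rw [Ideal.map_sup, Ideal.map_pow, Ideal.map_span, Set.image_pair, map_X, map_X]
    exact sup_le hle hn

end Staircase

/-! ### The main theorem -/

open Staircase in
theorem mainTheorem3 {K : Type*} [Field K] {t : ℕ} (f : Fin t → MvPolynomial (Fin 2) K)
    (I : Ideal (MvPolynomial (Fin 2) K))
    (hprim : I.IsPrimary) (hrad : I.radical = Ideal.span {varX K, varY K})
    (hcomp : ∃ I' : Ideal (MvPolynomial (Fin 2) K),
      I ⊔ I' = ⊤ ∧ I * I' = Ideal.span (Set.range f))
    (E : Staircase) (hE : initialIdeal I = E.monomialIdeal K) :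
    ∃ lam : E.Param → K,
      -- `lam` is the unique vector of Gröbner parameters of `I`
      (∀ lam' : E.Param → K, E.idealOf lam' = I ↔ lam' = lam) ∧
      -- the parameters that are not punctual vanish
      (∀ p : E.Param, ¬ E.IsPunctual p → lam p = 0) ∧
      -- the punctual equations generate the maximal ideal of the punctual parameters
      Ideal.span (Set.range fun q : Fin t × E.seg => E.punctualEquation (f q.1) q.2) =
        Ideal.span (Set.range fun p : E.PunctualParam => X p - C (lam p.1)) ∧
      (Ideal.span (Set.range fun q : Fin t × E.seg =>
        E.punctualEquation (f q.1) q.2)).IsMaximal ∧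
      -- the punctual parameters are the unique solution over an algebraic closure
      (∀ a : E.PunctualParam → AlgebraicClosure K,
        (∀ (i : Fin t) (μ : E.seg), aeval a (E.punctualEquation (f i) μ) = 0) ↔
          a = fun p => algebraMap K (AlgebraicClosure K) (lam p.1)) ∧
      -- this solution is simple: it has multiplicity one and the Jacobian matrix has trivial kernel
      solutionMultiplicity
        (Ideal.span (Set.range fun q : Fin t × E.seg => E.punctualEquation (f q.1) q.2))
        (fun p : E.PunctualParam => lam p.1) = 1 ∧
      (∀ v : E.PunctualParam → K,
        (∀ (i : Fin t) (μ : E.seg), ∑ p : E.PunctualParam,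
          eval (fun p : E.PunctualParam => lam p.1) (pderiv p (E.punctualEquation (f i) μ)) * v p
            = 0) → v = 0) := by
  obtain ⟨I', hsup, hmul⟩ := hcomp
  have hP : I ≤ Ideal.span {varX K, varY K} := hrad ▸ Ideal.le_radical
  obtain ⟨M, hM⟩ : varX K ∈ I.radical := by rw [hrad]; exact Ideal.subset_span (by simp)
  obtain ⟨N, hN⟩ : varY K ∈ I.radical := by rw [hrad]; exact Ideal.subset_span (by simp)
  obtain ⟨lam, hdiag, hI⟩ := exists_params hE hM
  have hpunct : ∀ p, ¬ E.IsPunctual p → lam p = 0 :=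
    hdiag.eq_zero_of_not_punctual (by rwa [hI])
  have hext : extendParam (fun p : E.PunctualParam => lam p.1) = lam := by
    funext p
    by_cases hp : E.IsPunctual p
    · exact extendParam_coe _ ⟨p, hp⟩
    · rw [extendParam_of_not p hp, hpunct p hp]
  set F : Fin t × E.seg → MvPolynomial E.PunctualParam K :=
    fun q => E.punctualEquation (f q.1) q.2 with hF
  set Q := Ideal.span (Set.range F) with hQ
  have hQpoint : Q = pointIdeal fun p : E.PunctualParam => lam p.1 := by
    refine le_antisymm (Ideal.span_le.2 ?_) ?_
    · rintro _ ⟨⟨i, μ⟩, rfl⟩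
      refine (punctualEquation_eq_zero_iff (eval fun p : E.PunctualParam => lam p.1) (f i)).2 ?_ μ
      have h1 : (eval fun p : E.PunctualParam => lam p.1).comp C = RingHom.id K :=
        RingHom.ext fun r => eval_C r
      simp only [eval_X, h1, hext, map_id, hI]
      have h2 : f i ∈ I * I' := by
        rw [hmul]; exact Ideal.subset_span (Set.mem_range_self i)
      exact Ideal.mul_le_left h2
    · rw [pointIdeal_eq_span, Ideal.span_le]
      rintro _ ⟨p, rfl⟩
      -- The tautological point over `K[Λ] / Q`: its coordinates are the classes of the
      -- indeterminates, and it solves the equations by construction. Rigidity identifies these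
      -- classes with the constants `lam p`.
      have h1 := eq_of_map_le (κ := (Ideal.Quotient.mk Q).comp C)
        (c := extendParam fun p => Ideal.Quotient.mk Q (X p)) hP hsup hdiag hI
        extendParam_of_not (by
          rw [hmul, Ideal.map_span, Ideal.span_le]
          rintro _ ⟨_, ⟨i, rfl⟩, rfl⟩
          exact (punctualEquation_eq_zero_iff (Ideal.Quotient.mk Q) (f i)).1 fun μ =>
            Ideal.Quotient.eq_zero_iff_mem.2 (Ideal.subset_span (Set.mem_range_self (i, μ))))
      have h2 := congrFun h1 p.1
      rw [extendParam_coe] at h2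
      exact Ideal.Quotient.eq.1 h2
  have hQspan := hQpoint.trans (pointIdeal_eq_span _)
  refine ⟨lam, fun lam' => ⟨fun h => ?_, fun h => h ▸ hI⟩, hpunct, hQspan,
    hQpoint ▸ isMaximal_pointIdeal _, fun a => ⟨fun ha => ?_, ?_⟩,
    hQpoint ▸ solutionMultiplicity_pointIdeal _,
    fun v hv => eq_zero_of_span_eq_pointIdeal hQpoint fun q => hv q.1 q.2⟩
  -- An arbitrary `lam'` may a priori have nonzero diagonal; this is excluded because `I` contains
  -- `x ^ m s`, the last basis element for `lam`.
  · refine eq_of_idealOf_le (diagZero_of_mem ?_) hdiag (h.trans hI.symm).le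
    rw [h, ← hI, ← hdiag.h_last]
    exact h_mem lam le_rfl
  · have hle : Q ≤ RingHom.ker (aeval a : MvPolynomial E.PunctualParam K →ₐ[K] _) := by
      rw [hQ, Ideal.span_le]
      rintro _ ⟨q, rfl⟩
      exact ha q.1 q.2
    funext p
    have h1 := hle (hQpoint ▸ X_sub_C_mem_pointIdeal (fun p : E.PunctualParam => lam p.1) p)
    rw [RingHom.mem_ker, map_sub, aeval_X, aeval_C] at h1
    exact sub_eq_zero.1 h1
  · rintro rfl i μ
    have h1 : F (i, μ) ∈ pointIdeal fun p : E.PunctualParam => lam p.1 :=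
      hQpoint ▸ Ideal.subset_span (Set.mem_range_self (i, μ))
    have h2 : eval (fun p : E.PunctualParam => lam p.1) (E.punctualEquation (f i) μ) = 0 := h1
    have h3 := aeval_algebraMap_apply (AlgebraicClosure K) (fun p : E.PunctualParam => lam p.1)
      (E.punctualEquation (f i) μ)
    exact h3.trans ((congrArg _ ((DFunLike.congr_fun (coe_aeval_eq_eval _) _).trans h2)).trans
      (map_zero _))
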